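/- Let $g:\mathbb R\to\mathbb C$ and $\omega:\mathbb R\to\mathbb R$ be such that the integral $G(t)=\int_{\mathbb R}|g(k)|^2e^{-i\omega(k)t}\,dk$ converges for all $t\ge 0$ and defines a continuous function (the bath correlation function). Let $\tilde G(p)=\int_0^{+\infty}e^{-pt}G(t)\,dt$ be its Laplace transform ($\operatorname{Re}p>0$), and assume that $\tilde G$ extends to the closed half-plane $\operatorname{Re}p\ge 0$ as a twice continuously (complex) differentiable function with bounded second derivative; the extension and its derivatives (one-sided on $\operatorname{Re}p=0$) are still denoted by $\tilde G,\tilde G'$. Let $H_S^{(0)},H_S^{(2)}$ be Hermitian $N\times N$ matrices and, for real $\lambda\ne 0$, let $V_\lambda(t)$, $t\ge0$, be the solution of $$\frac{d}{dt}V_\lambda(t)=-\lambda^2\int_0^t G(t-s)\,e^{i(H_S^{(0)}+\lambda^2H_S^{(2)})(t-s)}\,V_\lambda(s)\,ds,\qquad V_\lambda(0)=1,$$ and put $W_\lambda(t)=V_\lambda(\lambda^{-2}t)$. For a Hermitian matrix $A=\sum_a a\,\Pi_a$ (spectral decomposition) write $F(-iA)=\sum_a F(-ia)\,\Pi_a$;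 let $\frac{\delta \tilde G}{\delta p}(x,y)=\frac{\tilde G(x)-\tilde G(y)}{x-y}$ for $x\ne y$ and $\frac{\delta \tilde G}{\delta p}(x,x)=\tilde G'(x)$; and, with $H_S^{(0)}=\sum_E E\,\Pi_E$, let $$\overset{2}{H_S^{(2)}}\frac{\delta\tilde G}{\delta p}(-i\overset{1}{H_S^{(0)}},-i\overset{3}{H_S^{(0)}})=\sum_{E,E'}\frac{\delta\tilde G}{\delta p}(-iE,-iE')\,\Pi_{E'}H_S^{(2)}\Pi_{E}$$ (Feynman ordering). Then for every fixed $t>0$, as $\lambda\to0$, $$W_\lambda(t)=e^{Lt}\,r+O(\lambda^4),$$ where $r=1-\lambda^2\tilde G'(-iH_S^{(0)})$ and $$L=-\tilde G(-iH_S^{(0)})+\lambda^2\Big(\tilde G'(-iH_S^{(0)})\,\tilde G(-iH_S^{(0)})+i\,\overset{2}{H_S^{(2)}}\frac{\delta\tilde G}{\delta p}(-i\overset{1}{H_S^{(0)}},-i\overset{3}{H_S^{(0)}})\Big).$$ -/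

import Mathlib

open Filter Topology MeasureTheory Set Asymptotics

namespace RWAModel

noncomputable section

/-- Square complex matrices of size `N`. -/
abbrev Mat (N : ℕ) : Type := Matrix (Fin N) (Fin N) ℂ

/-- The bath correlation function `G(t) = ∫ |g(k)|² e^{-i ω(k) t} dk` of a reservoir with
form factor `g` and dispersion relation `ω`. -/
def bathCorrelation (g : ℝ → ℂ) (ω : ℝ → ℝ) (t : ℝ) : ℂ :=
  ∫ k : ℝ, ((‖g k‖ ^ 2 : ℝ) : ℂ) * Complex.exp (-Complex.I * (ω k : ℂ) * (t : ℂ))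

/-- The integral defining the bath correlation function converges for every `t ≥ 0`, and it
defines a continuous function of `t ≥ 0`. -/
def BathAdmissible (g : ℝ → ℂ) (ω : ℝ → ℝ) : Prop :=
  (∀ t : ℝ, 0 ≤ t → Integrable fun k : ℝ =>
    ((‖g k‖ ^ 2 : ℝ) : ℂ) * Complex.exp (-Complex.I * (ω k : ℂ) * (t : ℂ))) ∧
  ContinuousOn (bathCorrelation g ω) (Ici 0)

/-- `V` solves `V'(t) = -∫₀ᵗ K(t-s) e^{i H (t-s)} V(s) ds` for `t ≥ 0` with `V(0) = 1`
(one-sided derivative at `t = 0`; derivative and integral of matrices are taken entrywise). -/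
def IsPropagator {N : ℕ} (K : ℝ → ℂ) (H : Mat N) (V : ℝ → Mat N) : Prop :=
  V 0 = 1 ∧
  ∀ t : ℝ, 0 ≤ t → ∀ i j : Fin N,
    HasDerivWithinAt (fun u : ℝ => V u i j)
      (-∫ s in (0 : ℝ)..t,
        (K (t - s) • (NormedSpace.exp ((Complex.I * ((t - s : ℝ) : ℂ)) • H) * V s)) i j)
      (Ici 0) t

/-- The closed right half-plane `Re p ≥ 0`. -/
def closedHalfPlane : Set ℂ := {p : ℂ | 0 ≤ p.re}

/-- `Gt p = ∫₀^∞ e^{-p t} G(t) dt` (as a convergent improper integral) for all `p` with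
`Re p > 0`.  On the line `Re p = 0` the value of a `Gt` that is continuous on the closed
half-plane is determined by this. -/
def IsLaplaceTransform (G : ℝ → ℂ) (Gt : ℂ → ℂ) : Prop :=
  ∀ p : ℂ, 0 < p.re →
    Tendsto (fun T : ℝ => ∫ t in (0 : ℝ)..T, Complex.exp (-p * (t : ℂ)) * G t) atTop (𝓝 (Gt p))

/-- The complex derivative `F'(p)`, one-sided (within `Re p ≥ 0`) at the points of the line
`Re p = 0`. -/
def hpDeriv (F : ℂ → ℂ) (p : ℂ) : ℂ := derivWithin F closedHalfPlane p

/-- `F` is twice continuously (complex) differentiable on the closed half-plane `Re p ≥ 0`, and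
its second derivative is bounded there. -/
def IsBoundedC2 (F : ℂ → ℂ) : Prop :=
  ContDiffOn ℂ 2 F closedHalfPlane ∧
  ∃ M : ℝ, ∀ p ∈ closedHalfPlane, ‖iteratedDerivWithin 2 F closedHalfPlane p‖ ≤ M

open Classical in
/-- The difference derivative `δF/δp (x, y)`. -/
def diffDeriv (F : ℂ → ℂ) (x y : ℂ) : ℂ :=
  if x = y then hpDeriv F x else (F x - F y) / (x - y)

/-- The function `f(A) = U diag(f(E_α)) U⁺` of a Hermitian matrix `A = U diag(E_α) U⁺`. -/
def matFun {N : ℕ} {A : Mat N} (hA : A.IsHermitian) (f : ℝ → ℂ) : Mat N :=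
  (hA.eigenvectorUnitary : Mat N) * Matrix.diagonal (fun α => f (hA.eigenvalues α)) *
    star (hA.eigenvectorUnitary : Mat N)

/-- The finite set of (distinct) eigenvalues of a Hermitian matrix. -/
def eigenvalueSet {N : ℕ} {A : Mat N} (hA : A.IsHermitian) : Finset ℝ :=
  Finset.univ.image hA.eigenvalues

open Classical in
/-- The spectral projector `Π_a` of a Hermitian matrix, so that `A = ∑ a Π_a`. -/
def specProj {N : ℕ} {A : Mat N} (hA : A.IsHermitian) (a : ℝ) : Mat N :=
  matFun hA (fun x => if x = a then 1 else 0)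

/-- The function `f(A₁, A₂, A₃)` of three Hermitian matrices with Feynman indices `2, 1, 3`:
`∑ f(a₁, a₂, a₃) Π_{a₃} Π_{a₁} Π_{a₂}`. -/
def feynman213 {N : ℕ} {A₁ A₂ A₃ : Mat N}
    (h₁ : A₁.IsHermitian) (h₂ : A₂.IsHermitian) (h₃ : A₃.IsHermitian)
    (f : ℝ → ℝ → ℝ → ℂ) : Mat N :=
  ∑ a₁ ∈ eigenvalueSet h₁, ∑ a₂ ∈ eigenvalueSet h₂, ∑ a₃ ∈ eigenvalueSet h₃,
    f a₁ a₂ a₃ • (specProj h₃ a₃ * specProj h₁ a₁ * specProj h₂ a₂)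

/-- `F(-i A)` for a Hermitian matrix `A`. -/
def funNegI {N : ℕ} {A : Mat N} (hA : A.IsHermitian) (F : ℂ → ℂ) : Mat N :=
  matFun hA (fun E => F (-Complex.I * (E : ℂ)))

/-- The Feynman-ordered expression `H₂ · (δF/δp)(-i H₀, -i H₀)` in which `H₂` has index `2`, the
first copy of `H₀` has index `1` and the second one has index `3`.  As `δF/δp` is symmetric,
reversing the ordering convention gives the same matrix. -/
def orderedDiff {N : ℕ} {H₀ H₂ : Mat N} (h₀ : H₀.IsHermitian) (h₂ : H₂.IsHermitian)
    (F : ℂ → ℂ) : Mat N :=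
  feynman213 h₂ h₀ h₀ (fun a b c =>
    (a : ℂ) * diffDeriv F (-Complex.I * (b : ℂ)) (-Complex.I * (c : ℂ)))

/-- `r = 1 - λ² G̃'(-i H₀)`. -/
def rMat {N : ℕ} {H₀ : Mat N} (h₀ : H₀.IsHermitian) (Gt : ℂ → ℂ) (lam : ℝ) : Mat N :=
  1 - ((lam ^ 2 : ℝ) : ℂ) • funNegI h₀ (hpDeriv Gt)

/-- `L = -G̃(-i H₀) + λ² (G̃'(-i H₀) G̃(-i H₀) + i H₂ (δG̃/δp)(-i H₀, -i H₀))`, with the last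
term Feynman-ordered. -/
def LMat {N : ℕ} {H₀ H₂ : Mat N} (h₀ : H₀.IsHermitian) (h₂ : H₂.IsHermitian)
    (Gt : ℂ → ℂ) (lam : ℝ) : Mat N :=
  -funNegI h₀ Gt + ((lam ^ 2 : ℝ) : ℂ) •
    (funNegI h₀ (hpDeriv Gt) * funNegI h₀ Gt + Complex.I • orderedDiff h₀ h₂ Gt)

end

end RWAModel

/-!
The bath correlation function is the characteristic function of a finite measure, hence of positive
type, so that in an eigenbasis of the Hamiltonian the propagator splits into scalar Volterra
equations whose solutions do not grow. After rescaling time by `ε = λ²`, the Laplace transform of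
such a solution is `x₀ / (q + F (ε q + p₀))`, where `F = G̃` and `p₀ = -iE`. It is compared with the
single pole `x₀ / (q / r + F p₀)`, `r = 1 - ε F' p₀`: on a vertical line the second derivatives in
`q` differ by `O(ε² / |q|²)`, so Fourier inversion gives an `O(ε²)` error in time. The same model
written as a function of the perturbed Hamiltonian `H₀ + ε H₂` is then expanded to first order in
`ε`: its Daletskii–Krein first variation is the Feynman-ordered divided difference.
-/

namespace RWAModel

open Complex (I)
open scoped FourierTransform NNReal Real

section HalfPlane

lemma convex_closedHalfPlane : Convex ℝ closedHalfPlane :=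
  convex_halfSpace_re_ge 0

lemma mem_closedHalfPlane {p : ℂ} : p ∈ closedHalfPlane ↔ 0 ≤ p.re :=
  Iff.rfl

lemma isOpen_setOf_re_pos : IsOpen {p : ℂ | 0 < p.re} :=
  isOpen_lt continuous_const Complex.continuous_re

lemma setOf_re_pos_subset_closedHalfPlane : {p : ℂ | 0 < p.re} ⊆ closedHalfPlane :=
  fun _ hp => le_of_lt (mem_ofPred.1 hp)

lemma closedHalfPlane_mem_nhds {p : ℂ} (hp : 0 < p.re) : closedHalfPlane ∈ 𝓝 p :=
  mem_of_superset (isOpen_setOf_re_pos.mem_nhds hp) setOf_re_pos_subset_closedHalfPlane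

lemma uniqueDiffOn_closedHalfPlane : UniqueDiffOn ℂ closedHalfPlane :=
  uniqueDiffOn_convex_of_isRCLikeNormedField convex_closedHalfPlane
    ⟨1, mem_interior_iff_mem_nhds.2 (closedHalfPlane_mem_nhds (by simp))⟩

lemma norm_image_sub_sub_smul_le_of_lipschitzOn_deriv {𝕜 E : Type*} [RCLike 𝕜]
    [NormedAddCommGroup E] [NormedSpace 𝕜 E] {F F' : 𝕜 → E} {s : Set 𝕜} {K : ℝ≥0}
    (hs : Convex ℝ s) (hF : ∀ z ∈ s, HasDerivWithinAt F (F' z) s z)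
    (hF' : LipschitzOnWith K F' s) {p q : 𝕜} (hp : p ∈ s) (hq : q ∈ s) :
    ‖F q - F p - (q - p) • F' p‖ ≤ K * ‖q - p‖ ^ 2 := by
  set u := s ∩ Metric.closedBall p ‖q - p‖
  have hu : Convex ℝ u := hs.inter (convex_closedBall _ _)
  have hderiv : ∀ z ∈ u, HasDerivWithinAt (fun z => F z - z • F' p) (F' z - F' p) u z := by
    intro z hz
    have h := ((hF z hz.1).mono inter_subset_left).sub
      ((hasDerivWithinAt_id z u).smul_const (F' p))
    rwa [one_smul] at h
  have hbound : ∀ z ∈ u, ‖F' z - F' p‖ ≤ K * ‖q - p‖ := fun z hz =>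
    (hF'.norm_sub_le hz.1 hp).trans
      (mul_le_mul_of_nonneg_left (by simpa [dist_eq_norm] using hz.2) K.2)
  calc ‖F q - F p - (q - p) • F' p‖ = ‖F q - q • F' p - (F p - p • F' p)‖ := by
        rw [sub_smul]; congr 1; abel
    _ ≤ K * ‖q - p‖ * ‖q - p‖ := hu.norm_image_sub_le_of_norm_hasDerivWithin_le hderiv hbound
        ⟨hp, by simp⟩ ⟨hq, by simp [dist_eq_norm]⟩
    _ = K * ‖q - p‖ ^ 2 := by ring

/-- `F` is of class `C^{1,1}` on the closed half-plane, and `B` bounds `F`, `F'` and the Lipschitz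
constant of `F'`: this is what the resolvent estimates need to know about `G̃`. -/
structure IsBoundedC11 (F : ℂ → ℂ) (B : ℝ≥0) : Prop where
  differentiableOn : DifferentiableOn ℂ F closedHalfPlane
  norm_le : ∀ p ∈ closedHalfPlane, ‖F p‖ ≤ B
  norm_hpDeriv_le : ∀ p ∈ closedHalfPlane, ‖hpDeriv F p‖ ≤ B
  lipschitzOnWith : LipschitzOnWith B (hpDeriv F) closedHalfPlane

variable {F : ℂ → ℂ} {K B : ℝ≥0} {p q : ℂ}

lemma norm_taylor_hpDeriv_le (hF : DifferentiableOn ℂ F closedHalfPlane)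
    (hF' : LipschitzOnWith K (hpDeriv F) closedHalfPlane) (hp : p ∈ closedHalfPlane)
    (hq : q ∈ closedHalfPlane) : ‖F q - F p - (q - p) * hpDeriv F p‖ ≤ K * ‖q - p‖ ^ 2 :=
  norm_image_sub_sub_smul_le_of_lipschitzOn_deriv convex_closedHalfPlane
    (fun z hz => (hF z hz).hasDerivWithinAt) hF' hp hq

lemma IsBoundedC2.exists_lipschitzOnWith (hF : IsBoundedC2 F) :
    ∃ K : ℝ≥0, LipschitzOnWith K (hpDeriv F) closedHalfPlane := by
  obtain ⟨hF, M, hM⟩ := hF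
  have hdiff : DifferentiableOn ℂ (hpDeriv F) closedHalfPlane :=
    (hF.derivWithin uniqueDiffOn_closedHalfPlane (m := 1) (by norm_num)).differentiableOn
      one_ne_zero
  refine ⟨M.toNNReal, convex_closedHalfPlane.lipschitzOnWith_of_nnnorm_derivWithin_le hdiff
    fun p hp => ?_⟩
  have hiter : derivWithin (hpDeriv F) closedHalfPlane p =
      iteratedDerivWithin 2 F closedHalfPlane p := by
    rw [iteratedDerivWithin_succ, iteratedDerivWithin_one]
    rfl
  rw [hiter, ← NNReal.coe_le_coe]
  exact (hM p hp).trans (Real.le_coe_toNNReal M)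

lemma exists_isBoundedC11 (hF : DifferentiableOn ℂ F closedHalfPlane)
    (hF' : LipschitzOnWith K (hpDeriv F) closedHalfPlane) {C : ℝ≥0}
    (hC : ∀ p : ℂ, 1 ≤ p.re → ‖F p‖ ≤ C) : ∃ B, IsBoundedC11 F B := by
  have mem_add_one : ∀ {p : ℂ}, p ∈ closedHalfPlane → p + 1 ∈ closedHalfPlane := by
    intro p hp
    simp only [mem_closedHalfPlane, Complex.add_re, Complex.one_re] at hp ⊢
    linarith
  have hderiv_one : ∀ p ∈ closedHalfPlane, ‖hpDeriv F (p + 1)‖ ≤ 2 * C + K := by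
    intro p hp
    have htaylor := norm_taylor_hpDeriv_le hF hF' (mem_add_one hp) (mem_add_one (mem_add_one hp))
    have h₁ := hC (p + 1) (by simpa using mem_closedHalfPlane.1 hp)
    have h₂ := hC (p + 1 + 1) (by simpa using mem_closedHalfPlane.1 (mem_add_one hp))
    simp only [add_sub_cancel_left, one_mul, norm_one, one_pow, mul_one] at htaylor
    linarith [norm_sub_le (F (p + 1 + 1)) (F (p + 1)),
      norm_le_norm_add_norm_sub (F (p + 1 + 1) - F (p + 1)) (hpDeriv F (p + 1))]
  have hderiv : ∀ p ∈ closedHalfPlane, ‖hpDeriv F p‖ ≤ 2 * C + 2 * K := by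
    intro p hp
    have hlip := hF'.norm_sub_le (mem_add_one hp) hp
    simp only [add_sub_cancel_left, norm_one, mul_one] at hlip
    linarith [hderiv_one p hp, norm_le_norm_add_norm_sub (hpDeriv F (p + 1)) (hpDeriv F p)]
  have hbound : ∀ p ∈ closedHalfPlane, ‖F p‖ ≤ 3 * C + 2 * K := by
    intro p hp
    have htaylor := norm_taylor_hpDeriv_le hF hF' (mem_add_one hp) hp
    have h₁ := hC (p + 1) (by simpa using mem_closedHalfPlane.1 hp)
    simp only [sub_add_cancel_left, neg_mul, one_mul, sub_neg_eq_add, norm_neg, norm_one, one_pow,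
      mul_one] at htaylor
    have hsum : F p = F p - F (p + 1) + hpDeriv F (p + 1) + F (p + 1) - hpDeriv F (p + 1) := by
      ring
    rw [hsum]
    refine (norm_sub_le _ _).trans ?_
    linarith [hderiv_one p hp, norm_add_le (F p - F (p + 1) + hpDeriv F (p + 1)) (F (p + 1))]
  refine ⟨3 * C + 2 * K, hF, fun p hp => mod_cast hbound p hp, fun p hp => ?_,
    hF'.weaken ?_⟩
  · push_cast
    exact (hderiv p hp).trans (by linarith [C.coe_nonneg])
  · exact le_add_left (by linarith [K.2])

lemma IsBoundedC11.hasDerivAt (hF : IsBoundedC11 F B) (hp : 0 < p.re) :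
    HasDerivAt F (hpDeriv F p) p :=
  (hF.differentiableOn p (le_of_lt hp)).hasDerivWithinAt.hasDerivAt (closedHalfPlane_mem_nhds hp)

lemma IsBoundedC11.hasDerivAt_hpDeriv (hF : IsBoundedC11 F B) (hp : 0 < p.re) :
    HasDerivAt (hpDeriv F) (deriv (hpDeriv F) p) p := by
  have hd : DifferentiableOn ℂ (deriv F) {z : ℂ | 0 < z.re} :=
    (hF.differentiableOn.mono setOf_re_pos_subset_closedHalfPlane).deriv isOpen_setOf_re_pos
  have heq : deriv F =ᶠ[𝓝 p] hpDeriv F :=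
    mem_of_superset (isOpen_setOf_re_pos.mem_nhds hp) fun z hz => (hF.hasDerivAt hz).deriv
  exact (hd.differentiableAt (isOpen_setOf_re_pos.mem_nhds hp)).congr_of_eventuallyEq heq.symm
    |>.hasDerivAt

lemma IsBoundedC11.norm_deriv_hpDeriv_le (hF : IsBoundedC11 F B) (hp : 0 < p.re) :
    ‖deriv (hpDeriv F) p‖ ≤ B :=
  norm_deriv_le_of_lipschitzOn (closedHalfPlane_mem_nhds hp) hF.lipschitzOnWith

end HalfPlane

section SpectralMeasure

lemma charFun_map_add_const_real (ν : Measure ℝ) (E t : ℝ) :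
    charFun (ν.map (· + E)) t = Complex.exp (I * E * t) * charFun ν t := by
  rw [charFun_map_add_const, mul_comm]
  congr 2
  simp only [RCLike.inner_apply, conj_trivial]
  push_cast
  ring

lemma tendsto_mul_sin_div (x : ℝ) :
    Tendsto (fun n : ℕ => ((n : ℝ) + 1) * Real.sin (1 / ((n : ℝ) + 1) * x)) atTop (𝓝 x) := by
  have hlim : Tendsto (fun n : ℕ => x * Real.sinc (1 / ((n : ℝ) + 1) * x)) atTop (𝓝 x) := by
    simpa using ((Real.continuous_sinc.tendsto _).comp
      (tendsto_one_div_add_atTop_nhds_zero_nat.mul_const x)).const_mul x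
  refine hlim.congr fun n => ?_
  rcases eq_or_ne x 0 with rfl | hx
  · simp
  · rw [Real.sinc_of_ne_zero (by positivity)]
    field_simp

lemma aemeasurable_of_forall_exp_mul_I {α : Type*} [MeasurableSpace α] {μ : Measure α} {f : α → ℝ}
    (hf : ∀ t : ℝ, 0 < t → AEMeasurable (fun x => Complex.exp (t * f x * I)) μ) :
    AEMeasurable f μ := by
  refine aemeasurable_of_tendsto_metrizable_ae' (f := fun (n : ℕ) x =>
      ((n : ℝ) + 1) * (Complex.exp ((1 / ((n : ℝ) + 1) : ℝ) * f x * I)).im)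
    (fun n => (Complex.measurable_im.comp_aemeasurable (hf _ (by positivity))).const_mul _)
    (ae_of_all _ fun x => (tendsto_mul_sin_div (f x)).congr fun n => ?_)
  rw [← Complex.ofReal_mul, Complex.exp_ofReal_mul_I_im]

lemma exists_charFun_eq_integral_mul_exp {α : Type*} [MeasurableSpace α] {μ : Measure α}
    {w f : α → ℝ} (hw : ∀ x, 0 ≤ w x)
    (hint : ∀ t : ℝ, 0 ≤ t → Integrable (fun x => (w x : ℂ) * Complex.exp (t * f x * I)) μ) :
    ∃ ν : Measure ℝ, IsFiniteMeasure ν ∧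
      ∀ t : ℝ, charFun ν t = ∫ x, (w x : ℂ) * Complex.exp (t * f x * I) ∂μ := by
  have hw_int : Integrable w μ := by
    simpa [abs_of_nonneg (hw _)] using (hint 0 le_rfl).norm
  set m : Measure α := μ.withDensity fun x => ENNReal.ofReal (w x)
  have : IsFiniteMeasure m := isFiniteMeasure_withDensity_ofReal hw_int.2
  have hw_pos : ∀ᵐ x ∂m, 0 < w x := by
    rw [ae_withDensity_iff' hw_int.1.aemeasurable.ennreal_ofReal]
    exact ae_of_all _ fun x hx => by simpa using hx
  have hac : m ≪ μ := withDensity_absolutelyContinuous _ _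
  have hf : AEMeasurable f m := aemeasurable_of_forall_exp_mul_I fun t ht => by
    refine (((hint t ht.le).1.aemeasurable.mono_ac hac).div
      (hw_int.1.aemeasurable.complex_ofReal.mono_ac hac)).congr ?_
    filter_upwards [hw_pos] with x hx
    exact mul_div_cancel_left₀ _ (mod_cast hx.ne')
  refine ⟨m.map f, inferInstance, fun t => ?_⟩
  rw [charFun_apply_real, integral_map hf (by fun_prop),
    integral_withDensity_eq_integral_toReal_smul₀ hw_int.1.aemeasurable.ennreal_ofReal (by simp)]
  simp [ENNReal.toReal_ofReal (hw _)]

lemma BathAdmissible.exists_charFun_eq {g : ℝ → ℂ} {ω : ℝ → ℝ} (h : BathAdmissible g ω) :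
    ∃ ν : Measure ℝ, IsFiniteMeasure ν ∧ bathCorrelation g ω = charFun ν := by
  have hexp : ∀ k t : ℝ, Complex.exp (-I * ω k * t) = Complex.exp (t * (-ω k : ℝ) * I) := by
    intro k t
    push_cast
    ring_nf
  obtain ⟨ν, hν, hν_eq⟩ := exists_charFun_eq_integral_mul_exp (μ := volume)
    (w := fun k => ‖g k‖ ^ 2) (f := fun k => -ω k) (fun k => by positivity)
    fun t ht => by simpa only [hexp] using h.1 t ht
  refine ⟨ν, hν, funext fun t => ?_⟩
  simp only [bathCorrelation, hexp, hν_eq]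

end SpectralMeasure

section Volterra

/-- The Fourier transform in `s`, at frequency `θ`, of `x` truncated to `[0, t]`. Its square norm,
averaged over the spectral measure, is the energy lost by a solution of the Volterra equation. -/
noncomputable def truncFourier (x : ℝ → ℂ) (θ t : ℝ) : ℂ :=
  ∫ s in (0 : ℝ)..t, Complex.exp (-(s * θ * I)) * x s

variable {x : ℝ → ℂ} {ν : Measure ℝ}

lemma norm_exp_neg_mul_I (s θ : ℝ) : ‖Complex.exp (-(s * θ * I))‖ = 1 := by
  simp [Complex.norm_exp]

lemma continuous_truncFourier (hx : Continuous x) :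
    Continuous (Function.uncurry (truncFourier x)) :=
  intervalIntegral.continuous_parametric_intervalIntegral_of_continuous (a₀ := 0)
    (f := fun (z : ℝ × ℝ) (s : ℝ) => Complex.exp (-(s * z.1 * I)) * x s) (by fun_prop)
    continuous_snd

lemma hasDerivAt_truncFourier (hx : Continuous x) (θ t : ℝ) :
    HasDerivAt (truncFourier x θ) (Complex.exp (-(t * θ * I)) * x t) t :=
  ((by fun_prop : Continuous fun s : ℝ => Complex.exp (-(s * θ * I)) * x s)
    |>.integral_hasStrictDerivAt 0 t).hasDerivAt

lemma norm_truncFourier_le (x : ℝ → ℂ) (θ t : ℝ) :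
    ‖truncFourier x θ t‖ ≤ |∫ s in (0 : ℝ)..t, ‖x s‖| := by
  simpa only [truncFourier, norm_mul, norm_exp_neg_mul_I, one_mul] using
    intervalIntegral.norm_integral_le_abs_integral_norm (μ := volume) (a := 0) (b := t)
      (f := fun s : ℝ => Complex.exp (-(s * θ * I)) * x s)

/-- The derivative of `‖truncFourier x θ t‖²` in `t`. -/
noncomputable def dissipationRate (x : ℝ → ℂ) (t θ : ℝ) : ℝ :=
  2 * inner ℝ (x t) (Complex.exp (t * θ * I) * truncFourier x θ t)

lemma hasDerivAt_norm_sq_truncFourier (hx : Continuous x) (θ t : ℝ) :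
    HasDerivAt (fun t => ‖truncFourier x θ t‖ ^ 2) (dissipationRate x t θ) t := by
  unfold dissipationRate
  convert (hasDerivAt_truncFourier hx θ t).norm_sq using 2
  rw [real_inner_comm]
  simp only [Complex.inner, map_mul, ← Complex.exp_conj, Complex.conj_I,
    Complex.conj_ofReal]
  ring_nf

lemma integrable_uIoc_prod_of_continuous [IsFiniteMeasure ν] {E : Type*} [NormedAddCommGroup E]
    {f : ℝ → ℝ → E} {C : ℝ → ℝ} (hf : Continuous (Function.uncurry f)) (hC : Continuous C)
    (hfC : ∀ s θ, ‖f s θ‖ ≤ C s) (a b : ℝ) :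
    Integrable (Function.uncurry f) ((volume.restrict (uIoc a b)).prod ν) :=
  ((intervalIntegrable_iff.1 (hC.intervalIntegrable a b)).comp_fst ν).mono'
    hf.aestronglyMeasurable (ae_of_all _ fun z => hfC z.1 z.2)

lemma integral_charFun_sub_mul [IsFiniteMeasure ν] (hx : Continuous x) (t : ℝ) :
    ∫ s in (0 : ℝ)..t, charFun ν (t - s) * x s =
      ∫ θ, Complex.exp (t * θ * I) * truncFourier x θ t ∂ν := by
  have hkernel : ∀ s : ℝ, charFun ν (t - s) * x s =
      ∫ θ, Complex.exp (t * θ * I) * (Complex.exp (-(s * θ * I)) * x s) ∂ν := by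
    intro s
    rw [charFun_apply_real, ← integral_mul_const]
    congr 1 with θ
    rw [← mul_assoc, ← Complex.exp_add]
    congr 2
    push_cast
    ring
  have hint := integrable_uIoc_prod_of_continuous (ν := ν)
    (f := fun s θ : ℝ => Complex.exp (t * θ * I) * (Complex.exp (-(s * θ * I)) * x s))
    (C := fun s => ‖x s‖) (by fun_prop) hx.norm (fun s θ => by simp [Complex.norm_exp]) 0 t
  simp_rw [hkernel]
  rw [intervalIntegral_integral_swap hint]
  simp_rw [intervalIntegral.integral_const_mul]
  rfl

lemma norm_exp_mul_truncFourier_le (x : ℝ → ℂ) (t θ : ℝ) :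
    ‖Complex.exp (t * θ * I) * truncFourier x θ t‖ ≤ |∫ s in (0 : ℝ)..t, ‖x s‖| := by
  simpa [Complex.norm_exp] using norm_truncFourier_le x θ t

lemma continuous_exp_mul_truncFourier (hx : Continuous x) :
    Continuous fun z : ℝ × ℝ => Complex.exp (z.1 * z.2 * I) * truncFourier x z.2 z.1 := by
  have := (continuous_truncFourier hx).comp continuous_swap
  exact (by fun_prop : Continuous fun z : ℝ × ℝ => Complex.exp (z.1 * z.2 * I)).mul this

lemma continuous_dissipationRate (hx : Continuous x) :
    Continuous (Function.uncurry (dissipationRate x)) :=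
  ((hx.comp continuous_fst).inner (continuous_exp_mul_truncFourier hx)).const_mul 2

lemma integral_dissipationRate (hx : Continuous x) (θ T : ℝ) :
    ∫ t in (0 : ℝ)..T, dissipationRate x t θ = ‖truncFourier x θ T‖ ^ 2 := by
  rw [intervalIntegral.integral_eq_sub_of_hasDerivAt
    (fun t _ => hasDerivAt_norm_sq_truncFourier hx θ t)
    (((continuous_dissipationRate hx).comp (Continuous.prodMk_left θ)).intervalIntegrable _ _)]
  simp [truncFourier]

lemma integrable_dissipationRate [IsFiniteMeasure ν] (hx : Continuous x) (T : ℝ) :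
    Integrable (Function.uncurry (dissipationRate x))
      ((volume.restrict (uIoc 0 T)).prod ν) := by
  refine integrable_uIoc_prod_of_continuous
    (C := fun t => 2 * (‖x t‖ * |∫ s in (0 : ℝ)..t, ‖x s‖|)) (continuous_dissipationRate hx) ?_
    (fun t θ => ?_) 0 T
  · have := intervalIntegral.continuous_primitive
      (fun a b => hx.norm.intervalIntegrable (μ := volume) a b) 0
    fun_prop
  · rw [dissipationRate, norm_mul, Real.norm_ofNat]
    gcongr
    exact (norm_inner_le_norm _ _).trans (by gcongr; exact norm_exp_mul_truncFourier_le x t θ)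

lemma hasDerivAt_norm_sq_of_volterra [IsFiniteMeasure ν] {a t : ℝ} (hxc : Continuous x)
    (hx : HasDerivAt x (-(a * ∫ s in (0 : ℝ)..t, charFun ν (t - s) * x s)) t) :
    HasDerivAt (fun t => ‖x t‖ ^ 2) (-a * ∫ θ, dissipationRate x t θ ∂ν) t := by
  have hint : Integrable (fun θ : ℝ => Complex.exp (t * θ * I) * truncFourier x θ t) ν :=
    .of_bound ((continuous_exp_mul_truncFourier hxc).comp
      (Continuous.prodMk_right t)).aestronglyMeasurable _
      (ae_of_all _ (norm_exp_mul_truncFourier_le x t))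
  convert hx.norm_sq using 1
  unfold dissipationRate
  rw [integral_charFun_sub_mul hxc, ← neg_mul, ← Complex.ofReal_neg, ← Complex.real_smul,
    inner_smul_right, ← integral_inner hint, integral_const_mul]
  ring

lemma norm_sq_eq_of_volterra [IsFiniteMeasure ν] {a T : ℝ} (hxc : Continuous x)
    (hx : ∀ t, 0 < t → HasDerivAt x
      (-(a * ∫ s in (0 : ℝ)..t, charFun ν (t - s) * x s)) t) (hT : 0 ≤ T) :
    ‖x T‖ ^ 2 = ‖x 0‖ ^ 2 - a * ∫ θ, ‖truncFourier x θ T‖ ^ 2 ∂ν := by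
  have hrate := integrable_dissipationRate (ν := ν) hxc T
  have hFTC := intervalIntegral.integral_eq_sub_of_hasDerivAt_of_le hT
    (by fun_prop) (fun t ht => hasDerivAt_norm_sq_of_volterra hxc (hx t ht.1))
    ((intervalIntegrable_iff.2 hrate.integral_prod_left).const_mul _)
  rw [intervalIntegral.integral_const_mul, intervalIntegral_integral_swap hrate] at hFTC
  simp_rw [integral_dissipationRate hxc] at hFTC
  linarith

lemma norm_le_of_volterra [IsFiniteMeasure ν] {a T : ℝ} (ha : 0 ≤ a) (hxc : Continuous x)
    (hx : ∀ t, 0 < t → HasDerivAt x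
      (-(a * ∫ s in (0 : ℝ)..t, charFun ν (t - s) * x s)) t) (hT : 0 ≤ T) :
    ‖x T‖ ≤ ‖x 0‖ := by
  have hloss : 0 ≤ a * ∫ θ, ‖truncFourier x θ T‖ ^ 2 ∂ν :=
    mul_nonneg ha (integral_nonneg fun θ => by positivity)
  refine le_of_sq_le_sq ?_ (norm_nonneg _)
  linarith [norm_sq_eq_of_volterra hxc hx hT]

end Volterra

section Laplace

/-- The one-sided Laplace transform `∫₀^∞ e^{-pt} f(t) dt`, as a Bochner integral (so `0` unless
`LaplaceIntegrable f p`). -/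
noncomputable def laplaceIntegral (f : ℝ → ℂ) (p : ℂ) : ℂ :=
  ∫ t in Ioi (0 : ℝ), Complex.exp (-p * t) * f t

/-- Absolute convergence of the Laplace transform of `f` at `p`. -/
def LaplaceIntegrable (f : ℝ → ℂ) (p : ℂ) : Prop :=
  IntegrableOn (fun t : ℝ => Complex.exp (-p * t) * f t) (Ioi 0)

variable {f g : ℝ → ℂ} {p z : ℂ} {M b : ℝ}

lemma norm_exp_neg_mul (p : ℂ) (t : ℝ) : ‖Complex.exp (-p * t)‖ = Real.exp (-p.re * t) := by
  simp [Complex.norm_exp]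

lemma norm_exp_neg_mul_mul_le (hf : ∀ t, 0 < t → ‖f t‖ ≤ M * Real.exp (b * t)) (p : ℂ) {t : ℝ}
    (ht : 0 < t) : ‖Complex.exp (-p * t) * f t‖ ≤ M * Real.exp ((b - p.re) * t) := by
  rw [norm_mul, norm_exp_neg_mul]
  calc Real.exp (-p.re * t) * ‖f t‖ ≤ Real.exp (-p.re * t) * (M * Real.exp (b * t)) := by
        gcongr
        exact hf t ht
    _ = M * (Real.exp (-p.re * t) * Real.exp (b * t)) := by ring
    _ = M * Real.exp ((b - p.re) * t) := by rw [← Real.exp_add]; ring_nf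

lemma laplaceIntegrable_of_norm_le (hfc : Continuous f)
    (hf : ∀ t, 0 < t → ‖f t‖ ≤ M * Real.exp (b * t)) (hp : b < p.re) : LaplaceIntegrable f p :=
  ((integrableOn_exp_mul_Ioi (sub_neg.2 hp) 0).const_mul M).mono' (by fun_prop)
    ((ae_restrict_mem measurableSet_Ioi).mono fun _ ht => norm_exp_neg_mul_mul_le hf p ht)

lemma norm_laplaceIntegral_le (hf : ∀ t, 0 < t → ‖f t‖ ≤ M * Real.exp (b * t)) (hp : b < p.re) :
    ‖laplaceIntegral f p‖ ≤ M / (p.re - b) := by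
  have h := norm_integral_le_of_norm_le ((integrableOn_exp_mul_Ioi (sub_neg.2 hp) 0).const_mul M)
    ((ae_restrict_mem measurableSet_Ioi).mono fun _ ht => norm_exp_neg_mul_mul_le hf p ht)
  rw [integral_const_mul, integral_exp_mul_Ioi (sub_neg.2 hp), mul_zero, Real.exp_zero,
    neg_div, ← div_neg, neg_sub, mul_one_div] at h
  exact h

lemma laplaceIntegral_sub (hf : LaplaceIntegrable f p) (hg : LaplaceIntegrable g p) :
    laplaceIntegral (fun t => f t - g t) p = laplaceIntegral f p - laplaceIntegral g p := by
  simp only [laplaceIntegral, mul_sub]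
  exact integral_sub hf hg

lemma laplaceIntegral_const_mul (c : ℂ) (f : ℝ → ℂ) (p : ℂ) :
    laplaceIntegral (fun t => c * f t) p = c * laplaceIntegral f p := by
  simp only [laplaceIntegral, mul_left_comm _ c]
  exact integral_const_mul _ _

lemma laplaceIntegral_exp_mul (f : ℝ → ℂ) (z p : ℂ) :
    laplaceIntegral (fun t => Complex.exp (z * t) * f t) p = laplaceIntegral f (p - z) := by
  simp only [laplaceIntegral, ← mul_assoc, ← Complex.exp_add]
  congr! 4
  ring

lemma laplaceIntegral_exp (hp : z.re < p.re) :
    laplaceIntegral (fun t => Complex.exp (z * t)) p = (p - z)⁻¹ := by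
  have h := integral_exp_mul_complex_Ioi (a := z - p) (by simpa using hp) 0
  simp only [laplaceIntegral, ← Complex.exp_add, ← add_mul]
  rw [neg_add_eq_sub, h, Complex.ofReal_zero, mul_zero, Complex.exp_zero, neg_div, ← div_neg,
    neg_sub, one_div]

lemma laplaceIntegral_comp_mul_left {ε : ℝ} (hε : 0 < ε) (f : ℝ → ℂ) (p : ℂ) :
    laplaceIntegral (fun t => f (ε⁻¹ * t)) p = ε * laplaceIntegral f (ε * p) := by
  have h := integral_comp_mul_left_Ioi (fun t : ℝ => Complex.exp (-(ε * p) * t) * f t) 0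
    (inv_pos.2 hε)
  rw [mul_zero, inv_inv, Complex.real_smul] at h
  rw [laplaceIntegral, laplaceIntegral, ← h]
  congr! 4 with t
  have : (ε : ℂ) ≠ 0 := mod_cast hε.ne'
  push_cast
  field_simp

lemma hasDerivAt_exp_neg_mul (p : ℂ) (t : ℝ) :
    HasDerivAt (fun t : ℝ => Complex.exp (-p * t)) (-p * Complex.exp (-p * t)) t := by
  simpa [mul_comm] using ((hasDerivAt_id (t : ℂ)).const_mul (-p)).cexp.comp_ofReal

lemma laplaceIntegral_deriv {f' : ℝ → ℂ} (hfc : ContinuousWithinAt f (Ici 0) 0)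
    (hf' : ∀ t, 0 < t → HasDerivAt f (f' t) t) (hf_int : LaplaceIntegrable f p)
    (hf'_int : LaplaceIntegrable f' p) :
    laplaceIntegral f' p = p * laplaceIntegral f p - f 0 := by
  have hderiv : ∀ t ∈ Ioi (0 : ℝ), HasDerivAt (fun t : ℝ => Complex.exp (-p * t) * f t)
      (-p * (Complex.exp (-p * t) * f t) + Complex.exp (-p * t) * f' t) t := fun t ht =>
    ((hasDerivAt_exp_neg_mul p t).fun_mul (hf' t ht)).congr_deriv (by ring)
  have hderiv_int := (hf_int.const_mul (-p)).add hf'_int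
  have hFTC := integral_Ioi_of_hasDerivAt_of_tendsto
    ((by fun_prop : Continuous fun t : ℝ => Complex.exp (-p * t)).continuousWithinAt.mul hfc)
    hderiv hderiv_int (tendsto_zero_of_hasDerivAt_of_integrableOn_Ioi hderiv hderiv_int hf_int)
  rw [integral_add (hf_int.const_mul (-p)) hf'_int, integral_const_mul] at hFTC
  simp only [Pi.mul_apply, Complex.ofReal_zero, mul_zero, Complex.exp_zero, one_mul,
    zero_sub] at hFTC
  unfold laplaceIntegral
  linear_combination hFTC

lemma integral_mul_exp_mul_exp_sub (f g : ℝ → ℂ) (p : ℂ) (t : ℝ) :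
    ∫ s in (0 : ℝ)..t, ContinuousLinearMap.mul ℝ ℂ (Complex.exp (-p * s) * g s)
      (Complex.exp (-p * (t - s : ℝ)) * f (t - s)) =
    Complex.exp (-p * t) * ∫ s in (0 : ℝ)..t, f (t - s) * g s := by
  rw [← intervalIntegral.integral_const_mul]
  congr 1 with s
  have hexp : Complex.exp (-p * t) = Complex.exp (-p * s) * Complex.exp (-p * (t - s : ℝ)) := by
    rw [← Complex.exp_add]
    push_cast
    ring_nf
  rw [hexp, ContinuousLinearMap.mul_apply']
  ring

lemma LaplaceIntegrable.convolution (hf : LaplaceIntegrable f p) (hg : LaplaceIntegrable g p) :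
    LaplaceIntegrable (fun t => ∫ s in (0 : ℝ)..t, f (t - s) * g s) p := by
  refine (integrable_posConvolution hg hf (ContinuousLinearMap.mul ℝ ℂ)).integrableOn.congr_fun
    (fun t ht => ?_) measurableSet_Ioi
  rw [← integral_mul_exp_mul_exp_sub, posConvolution, indicator_of_mem ht]

lemma laplaceIntegral_convolution (hf : LaplaceIntegrable f p) (hg : LaplaceIntegrable g p) :
    laplaceIntegral (fun t => ∫ s in (0 : ℝ)..t, f (t - s) * g s) p =
      laplaceIntegral f p * laplaceIntegral g p := by
  simp only [laplaceIntegral, ← integral_mul_exp_mul_exp_sub]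
  rw [integral_posConvolution hg hf, ContinuousLinearMap.mul_apply', mul_comm]

lemma laplaceIntegral_volterra {a : ℝ} {k x : ℝ → ℂ} (hxc : ContinuousWithinAt x (Ici 0) 0)
    (hx : ∀ t, 0 < t → HasDerivAt x (-(a * ∫ s in (0 : ℝ)..t, k (t - s) * x s)) t)
    (hk_int : LaplaceIntegrable k p) (hx_int : LaplaceIntegrable x p) :
    (p + a * laplaceIntegral k p) * laplaceIntegral x p = x 0 := by
  have hderiv := laplaceIntegral_deriv hxc
    (fun t ht => (hx t ht).congr_deriv (neg_mul (a : ℂ) _).symm) hx_int ?_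
  · rw [laplaceIntegral_const_mul, laplaceIntegral_convolution hk_int hx_int] at hderiv
    linear_combination -hderiv
  · exact ((hk_int.convolution hx_int).const_mul (-a : ℂ)).congr
      (ae_of_all _ fun t => mul_left_comm _ _ _)

variable {ν : Measure ℝ}

lemma norm_charFun_le_mul_exp (t : ℝ) : ‖charFun ν t‖ ≤ ν.real univ * Real.exp (0 * t) := by
  simpa using norm_charFun_le t

variable [IsFiniteMeasure ν]

lemma laplaceIntegrable_charFun (hp : 0 < p.re) : LaplaceIntegrable (charFun ν) p :=
  laplaceIntegrable_of_norm_le continuous_charFun (fun t _ => norm_charFun_le_mul_exp t) hp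

lemma IsLaplaceTransform.laplaceIntegral_eq {F : ℂ → ℂ} (hF : IsLaplaceTransform f F)
    (hp : 0 < p.re) (hf : LaplaceIntegrable f p) : laplaceIntegral f p = F p :=
  tendsto_nhds_unique (intervalIntegral_tendsto_integral_Ioi 0 hf tendsto_id) (hF p hp)

lemma IsLaplaceTransform.norm_le_of_charFun {F : ℂ → ℂ} (hF : IsLaplaceTransform (charFun ν) F)
    (hp : 1 ≤ p.re) : ‖F p‖ ≤ ν.real univ := by
  have hp₀ : 0 < p.re := by linarith
  rw [← hF.laplaceIntegral_eq hp₀ (laplaceIntegrable_charFun hp₀)]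
  refine (norm_laplaceIntegral_le (fun t _ => norm_charFun_le_mul_exp t) hp₀).trans ?_
  exact div_le_self measureReal_nonneg (by linarith)

lemma IsLaplaceTransform.laplaceIntegral_charFun_map_add {F : ℂ → ℂ}
    (hF : IsLaplaceTransform (charFun ν) F) (E : ℝ) (hp : 0 < p.re) :
    laplaceIntegral (charFun (ν.map (· + E))) p = F (p - I * E) := by
  have hre : 0 < (p - I * E).re := by simpa using hp
  simp only [funext (charFun_map_add_const_real ν E)]
  rw [laplaceIntegral_exp_mul, hF.laplaceIntegral_eq hre (laplaceIntegrable_charFun hre)]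

end Laplace

section Fourier

lemma mul_norm_le_of_norm_fourier_deriv_two_le {E : Type*} [NormedAddCommGroup E]
    [NormedSpace ℂ E] [CompleteSpace E] {f D D₁ D₂ : ℝ → E} {S : ℝ → ℝ}
    (hf : ∀ n : ℕ, n ≤ 2 → Integrable fun t : ℝ => t ^ n • f t) (hD : 𝓕 f = D)
    (hD₁ : ∀ ξ, HasDerivAt D (D₁ ξ) ξ) (hD₂ : ∀ ξ, HasDerivAt D₁ (D₂ ξ) ξ)
    (hS : ∀ ξ, ‖D₂ ξ‖ ≤ S ξ) (hS_int : Integrable S) {t : ℝ} (ht : ContinuousAt f t) :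
    (2 * π * t) ^ 2 * ‖f t‖ ≤ ∫ ξ, S ξ := by
  set h : ℝ → E := fun t => (-2 * π * I * t) ^ 2 • f t
  have hh_int : Integrable h := by
    refine ((hf 2 le_rfl).smul ((-2 * π * I) ^ 2)).congr (ae_of_all _ fun s => ?_)
    simp only [h, Pi.smul_apply]
    rw [← Complex.coe_smul, smul_smul]
    push_cast
    ring_nf
  have hFourier : 𝓕 h = D₂ := by
    rw [← Real.iteratedDeriv_fourier (f := f) (N := 2) (n := 2)
      (fun n hn => hf n (by exact_mod_cast hn)) le_rfl,
      hD, iteratedDeriv_succ, iteratedDeriv_one, deriv_eq hD₁, deriv_eq hD₂]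
  have hD₂_int : Integrable D₂ := by
    refine hS_int.mono' ?_ (ae_of_all _ hS)
    rw [← deriv_eq hD₂]
    exact aestronglyMeasurable_deriv _ _
  have hinv := hh_int.fourierInv_fourier_eq (v := t) (by rwa [hFourier])
    (ContinuousAt.smul (by fun_prop) ht)
  rw [hFourier, Real.fourierInv_eq'] at hinv
  have hnorm : ‖h t‖ = (2 * π * t) ^ 2 * ‖f t‖ := by
    rw [norm_smul]
    congr 1
    simp [mul_pow, abs_of_pos Real.pi_pos]
  rw [← hnorm, ← hinv]
  refine norm_integral_le_of_norm_le hS_int (ae_of_all _ fun ξ => ?_)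
  rw [norm_smul, Complex.norm_exp_ofReal_mul_I, one_mul]
  exact hS ξ

lemma integrableOn_pow_smul_of_norm_le_mul_exp {E : Type*} [NormedAddCommGroup E]
    [NormedSpace ℝ E] {f : ℝ → E} {K b : ℝ} (hb : b < 0)
    (hfm : AEStronglyMeasurable f (volume.restrict (Ioi 0)))
    (hf : ∀ t, 0 < t → ‖f t‖ ≤ K * Real.exp (b * t)) (n : ℕ) :
    IntegrableOn (fun t : ℝ => t ^ n • f t) (Ioi 0) := by
  have hGamma := (integrableOn_rpow_mul_exp_neg_mul_rpow (s := n) (p := 1)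
    (by linarith [n.cast_nonneg (α := ℝ)]) one_pos (neg_pos.2 hb)).const_mul K
  refine hGamma.mono' (by fun_prop) ((ae_restrict_mem measurableSet_Ioi).mono fun t ht => ?_)
  rw [norm_smul, norm_pow, Real.norm_of_nonneg (mem_Ioi.1 ht).le, Real.rpow_natCast, Real.rpow_one,
    neg_neg, mul_left_comm]
  exact mul_le_mul_of_nonneg_left (hf t ht) (pow_nonneg (mem_Ioi.1 ht).le n)

lemma fourier_indicator_exp_neg_mul (d : ℝ → ℂ) (c : ℝ) :
    𝓕 ((Ioi (0 : ℝ)).indicator fun t => Complex.exp (-c * t) * d t) =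
      fun ξ : ℝ => laplaceIntegral d (c + 2 * π * ξ * I) := by
  ext ξ
  rw [Real.fourier_real_eq_integral_exp_smul, laplaceIntegral,
    ← integral_indicator measurableSet_Ioi]
  congr 1 with t
  by_cases ht : t ∈ Ioi (0 : ℝ)
  · rw [indicator_of_mem ht, indicator_of_mem ht, smul_eq_mul, ← mul_assoc, ← Complex.exp_add]
    push_cast
    ring_nf
  · simp [ht]

lemma integrable_inv_one_add_mul_sq {a : ℝ} (ha : a ≠ 0) :
    Integrable fun ξ : ℝ => (1 + (a * ξ) ^ 2)⁻¹ :=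
  integrable_inv_one_add_sq.comp_mul_left' ha

lemma integral_inv_one_add_mul_sq {a : ℝ} (ha : 0 < a) :
    ∫ ξ : ℝ, (1 + (a * ξ) ^ 2)⁻¹ = a⁻¹ * π := by
  rw [Measure.integral_comp_mul_left (fun ξ : ℝ => (1 + ξ ^ 2)⁻¹), integral_univ_inv_one_add_sq,
    abs_of_pos (inv_pos.2 ha), smul_eq_mul]

lemma sq_norm_add_two_pi_mul_I {c : ℝ} (hc : c ≠ 0) (ξ : ℝ) :
    ‖(c + 2 * π * ξ * I : ℂ)‖ ^ 2 = c ^ 2 * (1 + (2 * π / c * ξ) ^ 2) := by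
  have hparts : (c + 2 * π * ξ * I : ℂ) = (c : ℝ) + (2 * π * ξ : ℝ) * I := by push_cast; rfl
  rw [hparts, Complex.sq_norm, Complex.normSq_add_mul_I]
  field_simp

lemma sq_mul_norm_le_of_laplaceIntegral_eq {d : ℝ → ℂ} {D D₁ D₂ : ℂ → ℂ} {K b c S : ℝ}
    (hdc : Continuous d) (hd : ∀ t, 0 < t → ‖d t‖ ≤ K * Real.exp (b * t)) (hbc : b < c)
    (hc : 0 < c) (hD : ∀ q : ℂ, q.re = c → laplaceIntegral d q = D q)
    (hD₁ : ∀ q : ℂ, q.re = c → HasDerivAt D (D₁ q) q)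
    (hD₂ : ∀ q : ℂ, q.re = c → HasDerivAt D₁ (D₂ q) q)
    (hS : ∀ q : ℂ, q.re = c → ‖D₂ q‖ ≤ S / ‖q‖ ^ 2) {t : ℝ} (ht : 0 < t) :
    t ^ 2 * ‖d t‖ ≤ S * Real.exp (c * t) / (2 * c) := by
  set q : ℝ → ℂ := fun ξ => c + 2 * π * ξ * I
  have hq_re : ∀ ξ, (q ξ).re = c := fun ξ => by simp [q]
  have hq_deriv : ∀ ξ, HasDerivAt q (2 * π * I) ξ := fun ξ =>
    ((((hasDerivAt_id (ξ : ℂ)).const_mul (2 * π : ℂ)).mul_const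
      I).const_add (c : ℂ)).comp_ofReal.congr_deriv (by ring)
  set f : ℝ → ℂ := fun t => Complex.exp (-c * t) * d t
  have hf : ∀ t, 0 < t → ‖f t‖ ≤ K * Real.exp ((b - c) * t) := fun t ht =>
    norm_exp_neg_mul_mul_le hd c ht
  have hf_eq : (Ioi 0).indicator f =ᶠ[𝓝 t] f :=
    Filter.eventuallyEq_of_mem (Ioi_mem_nhds ht) fun s hs => indicator_of_mem hs f
  have key := mul_norm_le_of_norm_fourier_deriv_two_le (t := t)
    (fun n _ => ?_) ((fourier_indicator_exp_neg_mul d c).trans (funext fun ξ => hD _ (hq_re ξ)))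
    (fun ξ => (hD₁ _ (hq_re ξ)).scomp ξ (hq_deriv ξ))
    (fun ξ => ((hD₂ _ (hq_re ξ)).scomp ξ (hq_deriv ξ)).fun_const_smul _)
    (S := fun ξ => (2 * π) ^ 2 * S / c ^ 2 * (1 + (2 * π / c * ξ) ^ 2)⁻¹) (fun ξ => ?_)
    ((integrable_inv_one_add_mul_sq (by positivity)).const_mul _)
    ((by fun_prop : ContinuousAt f t).congr hf_eq.symm)
  · rw [integral_const_mul, integral_inv_one_add_mul_sq (by positivity), hf_eq.eq_of_nhds,
      norm_mul, norm_exp_neg_mul, Complex.ofReal_re, neg_mul, Real.exp_neg] at key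
    rw [le_div_iff₀ (by positivity)]
    field_simp at key
    rw [mul_comm c t]
    linear_combination key
  · have := (integrableOn_pow_smul_of_norm_le_mul_exp (sub_neg.2 hbc) (by fun_prop) hf n)
    exact (this.integrable_indicator measurableSet_Ioi).congr
      (ae_of_all _ fun s => congr_fun (indicator_smul _ _ _) s)
  · have h := hS _ (hq_re ξ)
    rw [sq_norm_add_two_pi_mul_I hc.ne'] at h
    simp only [norm_smul, norm_mul, Complex.norm_I, Complex.norm_ofNat, Complex.norm_real,
      Real.norm_of_nonneg Real.pi_pos.le, mul_one]
    calc _ ≤ 2 * π * (2 * π * (S / (c ^ 2 * (1 + (2 * π / c * ξ) ^ 2)))) := by gcongr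
      _ = _ := by field_simp

end Fourier

section Resolvent

lemma hasDerivAt_neg_div_sq {A A₁ : ℂ → ℂ} {A₂ q : ℂ} (hA : HasDerivAt A (A₁ q) q)
    (hA₁ : HasDerivAt A₁ A₂ q) (h0 : A q ≠ 0) :
    HasDerivAt (fun z => -A₁ z / A z ^ 2) (2 * A₁ q ^ 2 / A q ^ 3 - A₂ / A q ^ 2) q := by
  refine (hA₁.fun_neg.fun_div (hA.fun_pow 2) (pow_ne_zero 2 h0)).congr_deriv ?_
  field_simp
  ring

lemma norm_inv_le_two_mul_inv {m : ℝ} {z : ℂ} (hm : 0 < m) (hz : m / 2 ≤ ‖z‖) :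
    ‖z⁻¹‖ ≤ 2 * m⁻¹ := by
  rw [norm_inv, ← div_eq_mul_inv, ← inv_div]
  exact inv_anti₀ (by positivity) hz

lemma norm_cubic_sum_le {a b : ℂ} {s : ℝ} (ha : ‖a‖ ≤ s) (hb : ‖b‖ ≤ s) :
    ‖a ^ 2 + a * b + b ^ 2‖ ≤ 3 * s ^ 2 := by
  calc ‖a ^ 2 + a * b + b ^ 2‖ ≤ ‖a‖ ^ 2 + ‖a‖ * ‖b‖ + ‖b‖ ^ 2 :=
        norm_add₃_le.trans (by simp only [norm_pow, norm_mul, le_refl])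
    _ ≤ s ^ 2 + s * s + s ^ 2 := by gcongr; exact (norm_nonneg a).trans ha
    _ = 3 * s ^ 2 := by ring

lemma norm_sub_deriv_two_inv_le {A A₀ A₁ A₂ R : ℂ} {m δ : ℝ} (hm : 0 < m) (hA : m / 2 ≤ ‖A‖)
    (hA₀ : m / 2 ≤ ‖A₀‖) (hA₁ : ‖A₁‖ ≤ 2) (hR : ‖R‖ ≤ 2) (h₀ : ‖A - A₀‖ ≤ δ * m ^ 2)
    (h₁ : ‖A₁ - R‖ ≤ δ * m) (h₂ : ‖A₂‖ ≤ δ) :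
    ‖2 * A₁ ^ 2 / A ^ 3 - A₂ / A ^ 2 - 2 * R ^ 2 / A₀ ^ 3‖ ≤ 500 * δ / m ^ 2 := by
  have hδ : 0 ≤ δ := (norm_nonneg _).trans h₂
  have hA_ne : A ≠ 0 := norm_pos_iff.1 (by linarith)
  have hA₀_ne : A₀ ≠ 0 := norm_pos_iff.1 (by linarith)
  have ha := norm_inv_le_two_mul_inv hm hA
  have hb := norm_inv_le_two_mul_inv hm hA₀
  have hsum := norm_cubic_sum_le ha hb
  have hplus : ‖A₁ + R‖ ≤ 4 := (norm_add_le _ _).trans (by linarith)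
  have hsplit : 2 * A₁ ^ 2 / A ^ 3 - A₂ / A ^ 2 - 2 * R ^ 2 / A₀ ^ 3 =
      2 * ((A₁ - R) * (A₁ + R)) * A⁻¹ ^ 3 - A₂ * A⁻¹ ^ 2 -
        2 * R ^ 2 * ((A - A₀) * (A⁻¹ * A₀⁻¹) * (A⁻¹ ^ 2 + A⁻¹ * A₀⁻¹ + A₀⁻¹ ^ 2)) := by
    field_simp
    ring
  set a := A⁻¹
  set b := A₀⁻¹
  rw [hsplit]
  calc _ ≤ ‖2 * ((A₁ - R) * (A₁ + R)) * a ^ 3‖ + ‖A₂ * a ^ 2‖ +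
        ‖2 * R ^ 2 * ((A - A₀) * (a * b) * (a ^ 2 + a * b + b ^ 2))‖ :=
        (norm_sub_le _ _).trans (by gcongr; exact norm_sub_le _ _)
    _ = 2 * (‖A₁ - R‖ * ‖A₁ + R‖) * ‖a‖ ^ 3 + ‖A₂‖ * ‖a‖ ^ 2 +
        2 * ‖R‖ ^ 2 * (‖A - A₀‖ * (‖a‖ * ‖b‖) * ‖a ^ 2 + a * b + b ^ 2‖) := by
        simp only [norm_mul, norm_pow, Complex.norm_ofNat]
    _ ≤ 2 * ((δ * m) * 4) * (2 * m⁻¹) ^ 3 + δ * (2 * m⁻¹) ^ 2 +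
        2 * 2 ^ 2 * ((δ * m ^ 2) * ((2 * m⁻¹) * (2 * m⁻¹)) * (3 * (2 * m⁻¹) ^ 2)) := by gcongr
    _ = 452 * δ / m ^ 2 := by field_simp; ring
    _ ≤ _ := by gcongr; norm_num

/-- The residue factor `1 - ε F'(p₀)` of the approximate pole. -/
noncomputable def residue (F : ℂ → ℂ) (p₀ : ℂ) (ε : ℝ) : ℂ :=
  1 - ε * hpDeriv F p₀

/-- The symbol of the rescaled Volterra equation with kernel transform `F(· + p₀)`: the Laplace
transform of its solution is the initial value divided by `volterraSymbol`. -/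
noncomputable def volterraSymbol (F : ℂ → ℂ) (p₀ : ℂ) (ε : ℝ) (q : ℂ) : ℂ :=
  q + F (ε * q + p₀)

/-- The affine approximation of `volterraSymbol`; its reciprocal has a single pole, at
`-F(p₀) r`, with residue `r = residue F p₀ ε`. -/
noncomputable def poleSymbol (F : ℂ → ℂ) (p₀ : ℂ) (ε : ℝ) (q : ℂ) : ℂ :=
  q / residue F p₀ ε + F p₀

/-- The derivative of `volterraSymbol`. -/
noncomputable def volterraSymbolDeriv (F : ℂ → ℂ) (p₀ : ℂ) (ε : ℝ) (q : ℂ) : ℂ :=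
  1 + ε * hpDeriv F (ε * q + p₀)

variable {F : ℂ → ℂ} {B : ℝ≥0} {ε : ℝ} {p₀ p q : ℂ}

lemma re_mul_add_pos (hε : 0 < ε) (hp₀ : p₀ ∈ closedHalfPlane) (hq : 0 < q.re) :
    0 < (ε * q + p₀).re := by
  rw [Complex.add_re, Complex.re_ofReal_mul]
  exact add_pos_of_pos_of_nonneg (mul_pos hε hq) (mem_closedHalfPlane.1 hp₀)

namespace IsBoundedC11

lemma norm_mul_hpDeriv_le (hF : IsBoundedC11 F B) (hε : 0 ≤ ε) (hp : p ∈ closedHalfPlane) :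
    ‖ε * hpDeriv F p‖ ≤ ε * B := by
  rw [norm_mul, Complex.norm_real, Real.norm_of_nonneg hε]
  gcongr
  exact hF.norm_hpDeriv_le p hp

lemma norm_one_sub_residue_le (hF : IsBoundedC11 F B) (hε : 0 ≤ ε) (hp₀ : p₀ ∈ closedHalfPlane) :
    ‖1 - residue F p₀ ε‖ ≤ ε * B := by
  simpa only [residue, sub_sub_cancel] using hF.norm_mul_hpDeriv_le hε hp₀

lemma norm_residue_le (hF : IsBoundedC11 F B) (hε : 0 ≤ ε) (hεB : ε * B ≤ 1 / 2)
    (hp₀ : p₀ ∈ closedHalfPlane) : ‖residue F p₀ ε‖ ≤ 3 / 2 := by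
  have h := norm_sub_le (1 : ℂ) (1 - residue F p₀ ε)
  rw [sub_sub_cancel, norm_one] at h
  linarith [hF.norm_one_sub_residue_le hε hp₀]

lemma half_le_norm_residue (hF : IsBoundedC11 F B) (hε : 0 ≤ ε) (hεB : ε * B ≤ 1 / 2)
    (hp₀ : p₀ ∈ closedHalfPlane) : 1 / 2 ≤ ‖residue F p₀ ε‖ := by
  have h := norm_sub_norm_le (1 : ℂ) (1 - residue F p₀ ε)
  rw [sub_sub_cancel, norm_one] at h
  linarith [hF.norm_one_sub_residue_le hε hp₀]

lemma residue_ne_zero (hF : IsBoundedC11 F B) (hε : 0 ≤ ε) (hεB : ε * B ≤ 1 / 2)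
    (hp₀ : p₀ ∈ closedHalfPlane) : residue F p₀ ε ≠ 0 :=
  norm_pos_iff.1 (one_half_pos.trans_le (hF.half_le_norm_residue hε hεB hp₀))

lemma norm_residue_inv_le (hF : IsBoundedC11 F B) (hε : 0 ≤ ε) (hεB : ε * B ≤ 1 / 2)
    (hp₀ : p₀ ∈ closedHalfPlane) : ‖(residue F p₀ ε)⁻¹‖ ≤ 2 := by
  simpa using norm_inv_le_two_mul_inv one_pos (hF.half_le_norm_residue hε hεB hp₀)

lemma norm_one_sub_residue_sq_div_le (hF : IsBoundedC11 F B) (hε : 0 ≤ ε) (hεB : ε * B ≤ 1 / 2)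
    (hp₀ : p₀ ∈ closedHalfPlane) :
    ‖(1 - residue F p₀ ε) ^ 2 / residue F p₀ ε‖ ≤ 2 * B ^ 2 * ε ^ 2 := by
  rw [div_eq_mul_inv, norm_mul, norm_pow]
  calc _ ≤ (ε * B) ^ 2 * 2 := by
        gcongr
        exacts [hF.norm_one_sub_residue_le hε hp₀, hF.norm_residue_inv_le hε hεB hp₀]
    _ = _ := by ring

lemma half_norm_le_norm_volterraSymbol (hF : IsBoundedC11 F B) (hq : ε * q + p₀ ∈ closedHalfPlane)
    (hqB : 2 * B ≤ ‖q‖) : ‖q‖ / 2 ≤ ‖volterraSymbol F p₀ ε q‖ := by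
  have h := norm_sub_le_norm_add q (F (ε * q + p₀))
  rw [volterraSymbol]
  linarith [hF.norm_le _ hq]

lemma half_norm_le_norm_poleSymbol (hF : IsBoundedC11 F B) (hε : 0 ≤ ε) (hεB : ε * B ≤ 1 / 2)
    (hp₀ : p₀ ∈ closedHalfPlane) (hqB : 6 * B ≤ ‖q‖) : ‖q‖ / 2 ≤ ‖poleSymbol F p₀ ε q‖ := by
  have h := norm_sub_le_norm_add (q / residue F p₀ ε) (F p₀)
  have hdiv : ‖q‖ / (3 / 2) ≤ ‖q / residue F p₀ ε‖ := by
    have := hF.half_le_norm_residue hε hεB hp₀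
    rw [norm_div]
    gcongr
    exact hF.norm_residue_le hε hεB hp₀
  rw [poleSymbol]
  linarith [hF.norm_le p₀ hp₀]

lemma volterraSymbol_ne_zero (hF : IsBoundedC11 F B) (hε : 0 < ε) (hp₀ : p₀ ∈ closedHalfPlane)
    (hq : 6 * B + 2 ≤ q.re) : volterraSymbol F p₀ ε q ≠ 0 := by
  have hqn := hq.trans (Complex.re_le_norm q)
  have hre : 0 < q.re := lt_of_lt_of_le (by positivity) hq
  have h := hF.half_norm_le_norm_volterraSymbol (re_mul_add_pos hε hp₀ hre).le
    (by linarith [B.coe_nonneg])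
  exact norm_pos_iff.1 (by linarith [B.coe_nonneg])

lemma poleSymbol_ne_zero (hF : IsBoundedC11 F B) (hε : 0 ≤ ε) (hεB : ε * B ≤ 1 / 2)
    (hp₀ : p₀ ∈ closedHalfPlane) (hq : 6 * B + 2 ≤ q.re) : poleSymbol F p₀ ε q ≠ 0 := by
  have hqn := hq.trans (Complex.re_le_norm q)
  have h := hF.half_norm_le_norm_poleSymbol hε hεB hp₀ (by linarith : 6 * B ≤ ‖q‖)
  exact norm_pos_iff.1 (by linarith [B.coe_nonneg])

lemma norm_volterraSymbolDeriv_le (hF : IsBoundedC11 F B) (hε : 0 ≤ ε) (hεB : ε * B ≤ 1 / 2)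
    (hq : ε * q + p₀ ∈ closedHalfPlane) : ‖volterraSymbolDeriv F p₀ ε q‖ ≤ 2 := by
  have h := norm_add_le (1 : ℂ) (ε * hpDeriv F (ε * q + p₀))
  rw [norm_one] at h
  rw [volterraSymbolDeriv]
  linarith [hF.norm_mul_hpDeriv_le hε hq]

lemma norm_volterraSymbol_sub_poleSymbol_le (hF : IsBoundedC11 F B) (hε : 0 ≤ ε)
    (hεB : ε * B ≤ 1 / 2) (hp₀ : p₀ ∈ closedHalfPlane) (hq : ε * q + p₀ ∈ closedHalfPlane)
    (hq₁ : 1 ≤ ‖q‖) : ‖volterraSymbol F p₀ ε q - poleSymbol F p₀ ε q‖ ≤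
      (2 * B ^ 2 + B) * ε ^ 2 * ‖q‖ ^ 2 := by
  have hr := hF.residue_ne_zero hε hεB hp₀
  have hsplit : volterraSymbol F p₀ ε q - poleSymbol F p₀ ε q =
      (F (ε * q + p₀) - F p₀ - (ε * q + p₀ - p₀) * hpDeriv F p₀) -
        q * ((1 - residue F p₀ ε) ^ 2 / residue F p₀ ε) := by
    have hdef : (ε * q + p₀ - p₀) * hpDeriv F p₀ = q * (1 - residue F p₀ ε) := by
      rw [residue]
      ring
    rw [hdef, volterraSymbol, poleSymbol]
    field_simp
    ring
  have htaylor := norm_taylor_hpDeriv_le hF.differentiableOn hF.lipschitzOnWith hp₀ hq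
  have hrest := mul_le_mul_of_nonneg_left (hF.norm_one_sub_residue_sq_div_le hε hεB hp₀)
    (norm_nonneg q)
  rw [hsplit]
  refine (norm_sub_le _ _).trans ((add_le_add htaylor ((norm_mul_le _ _).trans hrest)).trans ?_)
  rw [add_sub_cancel_right, norm_mul, Complex.norm_real, Real.norm_of_nonneg hε]
  nlinarith [mul_le_mul_of_nonneg_left (le_self_pow₀ hq₁ two_ne_zero)
    (by positivity : 0 ≤ 2 * (B : ℝ) ^ 2 * ε ^ 2)]

lemma norm_volterraSymbolDeriv_sub_le (hF : IsBoundedC11 F B) (hε : 0 ≤ ε)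
    (hεB : ε * B ≤ 1 / 2) (hp₀ : p₀ ∈ closedHalfPlane) (hq : ε * q + p₀ ∈ closedHalfPlane)
    (hq₁ : 1 ≤ ‖q‖) : ‖volterraSymbolDeriv F p₀ ε q - (residue F p₀ ε)⁻¹‖ ≤
      (2 * B ^ 2 + B) * ε ^ 2 * ‖q‖ := by
  have hr := hF.residue_ne_zero hε hεB hp₀
  have hsplit : volterraSymbolDeriv F p₀ ε q - (residue F p₀ ε)⁻¹ =
      ε * (hpDeriv F (ε * q + p₀) - hpDeriv F p₀) -
        (1 - residue F p₀ ε) ^ 2 / residue F p₀ ε := by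
    have hdef : (ε : ℂ) * hpDeriv F p₀ = 1 - residue F p₀ ε := by
      rw [residue]
      ring
    rw [mul_sub, hdef, volterraSymbolDeriv]
    field_simp
    ring
  have hlip := hF.lipschitzOnWith.norm_sub_le hq hp₀
  rw [add_sub_cancel_right, norm_mul, Complex.norm_real, Real.norm_of_nonneg hε] at hlip
  rw [hsplit]
  refine (norm_sub_le _ _).trans ((add_le_add (norm_mul_le _ _)
    (hF.norm_one_sub_residue_sq_div_le hε hεB hp₀)).trans ?_)
  rw [Complex.norm_real, Real.norm_of_nonneg hε]
  nlinarith [mul_le_mul_of_nonneg_left hlip hε, mul_le_mul_of_nonneg_left hq₁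
    (by positivity : 0 ≤ 2 * (B : ℝ) ^ 2 * ε ^ 2)]

lemma hasDerivAt_volterraSymbol (hF : IsBoundedC11 F B) (hq : 0 < (ε * q + p₀).re) :
    HasDerivAt (volterraSymbol F p₀ ε) (volterraSymbolDeriv F p₀ ε q) q := by
  have hinner : HasDerivAt (fun q : ℂ => ε * q + p₀) ε q := by
    simpa using ((hasDerivAt_id q).const_mul (ε : ℂ)).add_const p₀
  exact ((hasDerivAt_id q).add ((hF.hasDerivAt hq).comp q hinner)).congr_deriv
    (by rw [volterraSymbolDeriv, mul_comm])

lemma hasDerivAt_volterraSymbolDeriv (hF : IsBoundedC11 F B) (hq : 0 < (ε * q + p₀).re) :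
    HasDerivAt (volterraSymbolDeriv F p₀ ε) (ε ^ 2 * deriv (hpDeriv F) (ε * q + p₀)) q := by
  have hinner : HasDerivAt (fun q : ℂ => ε * q + p₀) ε q := by
    simpa using ((hasDerivAt_id q).const_mul (ε : ℂ)).add_const p₀
  exact ((((hF.hasDerivAt_hpDeriv hq).comp q hinner).const_mul (ε : ℂ)).const_add 1).congr_deriv
    (by ring)

end IsBoundedC11

lemma hasDerivAt_poleSymbol (F : ℂ → ℂ) (p₀ : ℂ) (ε : ℝ) (q : ℂ) :
    HasDerivAt (poleSymbol F p₀ ε) (residue F p₀ ε)⁻¹ q :=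
  (((hasDerivAt_id q).div_const (residue F p₀ ε)).add_const (F p₀)).congr_deriv (one_div _)

/-- The second derivative of `1 / volterraSymbol - 1 / poleSymbol`. -/
noncomputable def resolventDiffDerivTwo (F : ℂ → ℂ) (p₀ : ℂ) (ε : ℝ) (q : ℂ) : ℂ :=
  2 * volterraSymbolDeriv F p₀ ε q ^ 2 / volterraSymbol F p₀ ε q ^ 3 -
    ε ^ 2 * deriv (hpDeriv F) (ε * q + p₀) / volterraSymbol F p₀ ε q ^ 2 -
    2 * (residue F p₀ ε)⁻¹ ^ 2 / poleSymbol F p₀ ε q ^ 3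

lemma IsBoundedC11.norm_resolventDiffDerivTwo_le (hF : IsBoundedC11 F B) (hε : 0 < ε)
    (hεB : ε * B ≤ 1 / 2) (hp₀ : p₀ ∈ closedHalfPlane) (hq : 6 * B + 2 ≤ q.re) :
    ‖resolventDiffDerivTwo F p₀ ε q‖ ≤ 500 * ((2 * B ^ 2 + B) * ε ^ 2) / ‖q‖ ^ 2 := by
  have hqn : 6 * B + 2 ≤ ‖q‖ := hq.trans (Complex.re_le_norm q)
  have : (0 : ℝ) ≤ B := B.2
  have hre : 0 < (ε * q + p₀).re := re_mul_add_pos hε hp₀ (by linarith)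
  have hmem : ε * q + p₀ ∈ closedHalfPlane := hre.le
  refine norm_sub_deriv_two_inv_le (by linarith)
    (hF.half_norm_le_norm_volterraSymbol hmem (by linarith))
    (hF.half_norm_le_norm_poleSymbol hε.le hεB hp₀ (by linarith))
    (hF.norm_volterraSymbolDeriv_le hε.le hεB hmem) (hF.norm_residue_inv_le hε.le hεB hp₀)
    (hF.norm_volterraSymbol_sub_poleSymbol_le hε.le hεB hp₀ hmem (by linarith))
    (hF.norm_volterraSymbolDeriv_sub_le hε.le hεB hp₀ hmem (by linarith)) ?_
  rw [norm_mul, norm_pow, Complex.norm_real, Real.norm_of_nonneg hε.le]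
  nlinarith [mul_le_mul_of_nonneg_left (hF.norm_deriv_hpDeriv_le hre) (sq_nonneg ε),
    mul_nonneg (sq_nonneg (B : ℝ)) (sq_nonneg ε)]

end Resolvent

section Scalar

variable {F : ℂ → ℂ} {B : ℝ≥0} {ν : Measure ℝ} [IsFiniteMeasure ν] {E ε M : ℝ} {p₀ q : ℂ}
  {x : ℝ → ℂ}

lemma laplaceIntegral_rescaled_volterra (hν : IsLaplaceTransform (charFun ν) F) (hε : 0 < ε)
    (hxc : Continuous x) (hxb : ∀ s, 0 < s → ‖x s‖ ≤ M)
    (hx : ∀ s, 0 < s → HasDerivAt x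
      (-(ε * ∫ u in (0 : ℝ)..s, charFun (ν.map (· + E)) (s - u) * x u)) s)
    (hq : 0 < q.re) (hA : volterraSymbol F (-I * E) ε q ≠ 0) :
    laplaceIntegral (fun τ => x (ε⁻¹ * τ)) q =
      x 0 * (volterraSymbol F (-I * E) ε q)⁻¹ := by
  have hre : 0 < ((ε : ℂ) * q).re := by
    rw [Complex.re_ofReal_mul]
    positivity
  have hsol := laplaceIntegral_volterra hxc.continuousWithinAt hx (laplaceIntegrable_charFun hre)
    (laplaceIntegrable_of_norm_le hxc (b := 0) (by simpa using hxb) hre)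
  rw [hν.laplaceIntegral_charFun_map_add E hre, sub_eq_add_neg, ← neg_mul] at hsol
  rw [laplaceIntegral_comp_mul_left hε, eq_mul_inv_iff_mul_eq₀ hA, ← hsol, volterraSymbol]
  ring

lemma laplaceIntegral_pole (hr : residue F p₀ ε ≠ 0) (hq : (-F p₀ * residue F p₀ ε).re < q.re) :
    laplaceIntegral (fun τ => residue F p₀ ε * Complex.exp (-F p₀ * residue F p₀ ε * τ)) q =
      (poleSymbol F p₀ ε q)⁻¹ := by
  rw [laplaceIntegral_const_mul, laplaceIntegral_exp hq, poleSymbol, div_add' _ _ _ hr, inv_div,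
    neg_mul, sub_neg_eq_add, div_eq_mul_inv]

lemma IsBoundedC11.norm_pole_le (hF : IsBoundedC11 F B) (hε : 0 ≤ ε) (hεB : ε * B ≤ 1 / 2)
    (hp₀ : p₀ ∈ closedHalfPlane) : ‖-F p₀ * residue F p₀ ε‖ ≤ 2 * B := by
  rw [norm_mul, norm_neg]
  nlinarith [mul_le_mul (hF.norm_le p₀ hp₀) (hF.norm_residue_le hε hεB hp₀) (norm_nonneg _) B.2,
    B.2]

lemma IsBoundedC11.norm_exp_pole_le (hF : IsBoundedC11 F B) (hε : 0 ≤ ε) (hεB : ε * B ≤ 1 / 2)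
    (hp₀ : p₀ ∈ closedHalfPlane) {τ : ℝ} (hτ : 0 ≤ τ) :
    ‖residue F p₀ ε * Complex.exp (-F p₀ * residue F p₀ ε * τ)‖ ≤
      2 * Real.exp (2 * B * τ) := by
  rw [norm_mul, Complex.norm_exp, Complex.re_mul_ofReal]
  gcongr
  · linarith [hF.norm_residue_le hε hεB hp₀]
  · exact (Complex.re_le_norm _).trans (hF.norm_pole_le hε hεB hp₀)

lemma laplaceIntegral_rescaled_sub_pole (hF : IsBoundedC11 F B)
    (hν : IsLaplaceTransform (charFun ν) F) (hε : 0 < ε) (hεB : ε * B ≤ 1 / 2)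
    (hxc : Continuous x) (hxb : ∀ s, 0 < s → ‖x s‖ ≤ M)
    (hx : ∀ s, 0 < s → HasDerivAt x
      (-(ε * ∫ u in (0 : ℝ)..s, charFun (ν.map (· + E)) (s - u) * x u)) s)
    (hp₀ : p₀ = -I * E) (hq : 2 * B < q.re) (hA : volterraSymbol F p₀ ε q ≠ 0) :
    laplaceIntegral (fun τ => x (ε⁻¹ * τ) -
        x 0 * (residue F p₀ ε * Complex.exp (-F p₀ * residue F p₀ ε * τ))) q =
      x 0 * ((volterraSymbol F p₀ ε q)⁻¹ - (poleSymbol F p₀ ε q)⁻¹) := by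
  have hp₀_mem : p₀ ∈ closedHalfPlane := by simp [mem_closedHalfPlane, hp₀]
  have hre : 0 < q.re := lt_of_le_of_lt (by positivity) hq
  have hsol_int : LaplaceIntegrable (fun τ => x (ε⁻¹ * τ)) q :=
    laplaceIntegrable_of_norm_le (M := M) (b := 0) (by fun_prop) (fun τ hτ => by
      simpa using hxb (ε⁻¹ * τ) (by positivity)) hre
  have hpole_int : LaplaceIntegrable (fun τ : ℝ => x 0 *
      (residue F p₀ ε * Complex.exp (-F p₀ * residue F p₀ ε * τ))) q := by
    refine laplaceIntegrable_of_norm_le (M := ‖x 0‖ * 2) (by fun_prop) (fun τ hτ => ?_) hq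
    rw [norm_mul, mul_assoc ‖x 0‖]
    exact mul_le_mul_of_nonneg_left (hF.norm_exp_pole_le hε.le hεB hp₀_mem hτ.le) (norm_nonneg _)
  rw [laplaceIntegral_sub hsol_int hpole_int, laplaceIntegral_const_mul,
    laplaceIntegral_pole (hF.residue_ne_zero hε.le hεB hp₀_mem)
      ((Complex.re_le_norm _).trans_lt ((hF.norm_pole_le hε.le hεB hp₀_mem).trans_lt hq)),
    hp₀, laplaceIntegral_rescaled_volterra hν hε hxc hxb hx hre (hp₀ ▸ hA), mul_sub]

lemma IsBoundedC11.sq_mul_norm_volterra_sub_exp_le (hF : IsBoundedC11 F B)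
    (hν : IsLaplaceTransform (charFun ν) F) (hε : 0 < ε) (hεB : ε * B ≤ 1 / 2)
    (hp₀ : p₀ = -I * E) (hxc : Continuous x)
    (hx : ∀ s, 0 < s → HasDerivAt x
      (-(ε * ∫ u in (0 : ℝ)..s, charFun (ν.map (· + E)) (s - u) * x u)) s) {t : ℝ} (ht : 0 < t) :
    t ^ 2 * ‖x (ε⁻¹ * t) -
        x 0 * (residue F p₀ ε * Complex.exp (-F p₀ * residue F p₀ ε * t))‖ ≤
      ‖x 0‖ * (500 * ((2 * B ^ 2 + B) * ε ^ 2)) * Real.exp ((6 * B + 2) * t) /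
        (2 * (6 * B + 2)) := by
  have : (0 : ℝ) ≤ B := B.2
  have hp₀_mem : p₀ ∈ closedHalfPlane := by simp [mem_closedHalfPlane, hp₀]
  have hxb : ∀ s, 0 < s → ‖x s‖ ≤ ‖x 0‖ := fun s hs => norm_le_of_volterra hε.le hxc hx hs.le
  have hre : ∀ {q : ℂ}, q.re = 6 * B + 2 → 0 < (ε * q + p₀).re := fun hq =>
    re_mul_add_pos hε hp₀_mem (by linarith)
  have hA : ∀ {q : ℂ}, q.re = 6 * B + 2 → volterraSymbol F p₀ ε q ≠ 0 := fun hq =>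
    hF.volterraSymbol_ne_zero hε hp₀_mem hq.ge
  have hA₀ : ∀ {q : ℂ}, q.re = 6 * B + 2 → poleSymbol F p₀ ε q ≠ 0 := fun hq =>
    hF.poleSymbol_ne_zero hε.le hεB hp₀_mem hq.ge
  refine sq_mul_norm_le_of_laplaceIntegral_eq (K := ‖x 0‖ * 3) (b := 2 * B)
    (by fun_prop) (fun τ hτ => ?_) (by linarith) (by positivity)
    (fun q hq => laplaceIntegral_rescaled_sub_pole hF hν hε hεB hxc hxb hx hp₀ (by linarith)
      (hA hq))
    (fun q hq => (((hF.hasDerivAt_volterraSymbol (hre hq)).fun_inv (hA hq)).fun_sub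
      ((hasDerivAt_poleSymbol F p₀ ε q).fun_inv (hA₀ hq))).const_mul (x 0))
    (D₂ := fun q => x 0 * resolventDiffDerivTwo F p₀ ε q) (fun q hq => ?_) (fun q hq => ?_) ht
  · have hone : 1 ≤ Real.exp (2 * B * τ) := Real.one_le_exp (by positivity)
    refine (norm_sub_le _ _).trans ?_
    rw [norm_mul]
    nlinarith [hxb (ε⁻¹ * τ) (by positivity), norm_nonneg (x 0), mul_le_mul_of_nonneg_left
      (hF.norm_exp_pole_le hε.le hεB hp₀_mem hτ.le) (norm_nonneg (x 0))]
  · have h := (hasDerivAt_neg_div_sq (hF.hasDerivAt_volterraSymbol (hre hq))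
      (hF.hasDerivAt_volterraSymbolDeriv (hre hq)) (hA hq)).fun_sub
      (hasDerivAt_neg_div_sq (hasDerivAt_poleSymbol F p₀ ε q) (hasDerivAt_const q _) (hA₀ hq))
    exact (h.const_mul (x 0)).congr_deriv (by rw [resolventDiffDerivTwo, zero_div, sub_zero])
  · rw [norm_mul, mul_div_assoc]
    gcongr
    exact hF.norm_resolventDiffDerivTwo_le hε hεB hp₀_mem hq.ge

end Scalar

section DividedDifference

variable {f f' : ℝ → ℂ} {K : ℝ≥0}

lemma dslope_eq_integral (hf : ∀ x, HasDerivAt f (f' x) x) (hf' : Continuous f') (b x : ℝ) :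
    dslope f b x = ∫ s in (0 : ℝ)..1, f' (b + s * (x - b)) := by
  have hderiv : ∀ s : ℝ, HasDerivAt (fun s : ℝ => f (b + s * (x - b)))
      ((x - b) • f' (b + s * (x - b))) s := fun s => by
    have hline : HasDerivAt (fun s : ℝ => b + s * (x - b)) (x - b) s := by
      simpa using ((hasDerivAt_id' s).mul_const (x - b)).const_add b
    exact (hf _).scomp s hline
  have hFTC := intervalIntegral.integral_eq_sub_of_hasDerivAt (a := 0) (b := 1)
    (fun s _ => hderiv s) (by apply Continuous.intervalIntegrable; fun_prop)
  rcases eq_or_ne x b with rfl | hx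
  · simp [dslope_same, (hf x).deriv]
  · rw [dslope_of_ne _ hx, slope_def_module, inv_smul_eq_iff₀ (sub_ne_zero.2 hx),
      ← intervalIntegral.integral_smul, hFTC]
    simp

lemma lipschitzWith_dslope (hf : ∀ x, HasDerivAt f (f' x) x) (hf' : LipschitzWith K f') (b : ℝ) :
    LipschitzWith K (dslope f b) := by
  have hc := hf'.continuous
  refine LipschitzWith.of_dist_le_mul fun x y => ?_
  rw [dist_eq_norm, dslope_eq_integral hf hc, dslope_eq_integral hf hc,
    ← intervalIntegral.integral_sub (by apply Continuous.intervalIntegrable; fun_prop)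
      (by apply Continuous.intervalIntegrable; fun_prop)]
  refine (intervalIntegral.norm_integral_le_of_norm_le_const (C := K * dist x y)
    fun s hs => ?_).trans (by simp)
  rw [uIoc_of_le zero_le_one] at hs
  rw [← dist_eq_norm]
  refine (hf'.dist_le_mul _ _).trans ?_
  rw [dist_add_left, Real.dist_eq, ← mul_sub, sub_sub_sub_cancel_right, abs_mul, abs_of_pos hs.1,
    Real.dist_eq]
  exact mul_le_mul_of_nonneg_left (mul_le_of_le_one_left (abs_nonneg _) hs.2) K.2

end DividedDifference

section FrobeniusNorm

open scoped Matrix Matrix.Norms.Frobenius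

variable {m n α β : Type*} [Fintype m] [Fintype n]

lemma frobenius_norm_mono [NormedAddCommGroup α] [NormedAddCommGroup β] {A : Matrix m n α}
    {B : Matrix m n β} (h : ∀ i j, ‖A i j‖ ≤ ‖B i j‖) : ‖A‖ ≤ ‖B‖ := by
  simp only [Matrix.frobenius_norm_def]
  gcongr
  exact h _ _

lemma frobenius_norm_sq_eq_trace (A : Matrix m n ℂ) : ((‖A‖ ^ 2 : ℝ) : ℂ) = (Aᴴ * A).trace := by
  rw [Matrix.frobenius_norm_def, ← Real.sqrt_eq_rpow, Real.sq_sqrt (by positivity),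
    Finset.sum_comm]
  simp [Matrix.trace, Matrix.mul_apply, Complex.conj_mul']

lemma frobenius_norm_unitary_mul [DecidableEq m] {U : Matrix m m ℂ}
    (hU : U ∈ Matrix.unitaryGroup m ℂ) (A : Matrix m n ℂ) : ‖U * A‖ = ‖A‖ := by
  have h : ((‖U * A‖ ^ 2 : ℝ) : ℂ) = ((‖A‖ ^ 2 : ℝ) : ℂ) := by
    rw [frobenius_norm_sq_eq_trace, frobenius_norm_sq_eq_trace, Matrix.conjTranspose_mul,
      Matrix.mul_assoc, ← Matrix.mul_assoc Uᴴ, ← Matrix.star_eq_conjTranspose U,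
      Matrix.mem_unitaryGroup_iff'.1 hU, Matrix.one_mul]
  exact (sq_eq_sq₀ (norm_nonneg _) (norm_nonneg _)).1 (Complex.ofReal_injective h)

lemma frobenius_norm_mul_unitary [DecidableEq n] {U : Matrix n n ℂ}
    (hU : U ∈ Matrix.unitaryGroup n ℂ) (A : Matrix m n ℂ) : ‖A * U‖ = ‖A‖ := by
  rw [← Matrix.frobenius_norm_conjTranspose, Matrix.conjTranspose_mul,
    ← Matrix.star_eq_conjTranspose U, frobenius_norm_unitary_mul (Unitary.star_mem hU),
    Matrix.frobenius_norm_conjTranspose]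

end FrobeniusNorm

section HermitianCalculus

variable {N : ℕ} {A A' A'' : Mat N} (hA : A.IsHermitian) (hA' : A'.IsHermitian)
  (hA'' : A''.IsHermitian)

/-- The matrix of an operator whose columns refer to an eigenbasis of `A` and whose rows refer
to an eigenbasis of `A'`, as a linear automorphism of the space of matrices. -/
noncomputable def inEigenbases : Mat N ≃ₗ[ℂ] Mat N where
  toFun B := star (hA'.eigenvectorUnitary : Mat N) * B * (hA.eigenvectorUnitary : Mat N)
  invFun B := (hA'.eigenvectorUnitary : Mat N) * B * star (hA.eigenvectorUnitary : Mat N)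
  map_add' B C := by simp only [mul_add, add_mul]
  map_smul' c B := by simp
  left_inv B := by
    simp only [← mul_assoc, Unitary.mul_star_self_of_mem hA'.eigenvectorUnitary.2, one_mul]
    rw [mul_assoc, Unitary.mul_star_self_of_mem hA.eigenvectorUnitary.2, mul_one]
  right_inv B := by
    simp only [← mul_assoc, Unitary.star_mul_self_of_mem hA'.eigenvectorUnitary.2, one_mul]
    rw [mul_assoc, Unitary.star_mul_self_of_mem hA.eigenvectorUnitary.2, mul_one]

lemma inEigenbases_mul (B C : Mat N) :
    inEigenbases hA hA'' (B * C) = inEigenbases hA' hA'' B * inEigenbases hA hA' C := by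
  simp only [inEigenbases, LinearEquiv.coe_mk, LinearMap.coe_mk, AddHom.coe_mk, mul_assoc]
  rw [← mul_assoc (hA'.eigenvectorUnitary : Mat N) (star _),
    Unitary.mul_star_self_of_mem hA'.eigenvectorUnitary.2, one_mul]

lemma inEigenbases_self_one : inEigenbases hA hA 1 = 1 := by
  simp [inEigenbases]

lemma matFun_eq_symm_diagonal (f : ℝ → ℂ) : matFun hA f =
    (inEigenbases hA hA).symm (Matrix.diagonal fun α => f (hA.eigenvalues α)) := rfl

lemma inEigenbases_matFun (f : ℝ → ℂ) : inEigenbases hA hA (matFun hA f) =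
    Matrix.diagonal fun α => f (hA.eigenvalues α) := by
  rw [matFun_eq_symm_diagonal, LinearEquiv.apply_symm_apply]

lemma matFun_mul (f g : ℝ → ℂ) : matFun hA (fun E => f E * g E) = matFun hA f * matFun hA g := by
  apply (inEigenbases hA hA).injective
  simp only [inEigenbases_mul hA hA hA, inEigenbases_matFun, Matrix.diagonal_mul_diagonal]

lemma matFun_sub (f g : ℝ → ℂ) : matFun hA (fun E => f E - g E) = matFun hA f - matFun hA g := by
  simp only [matFun_eq_symm_diagonal, ← map_sub, Matrix.diagonal_sub]

lemma matFun_const_mul (c : ℂ) (f : ℝ → ℂ) : matFun hA (fun E => c * f E) = c • matFun hA f := by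
  simp only [matFun_eq_symm_diagonal, ← map_smul, ← Matrix.diagonal_smul]
  rfl

lemma matFun_one : matFun hA (fun _ => 1) = 1 := by
  simp [matFun]

lemma matFun_id : matFun hA (fun E => (E : ℂ)) = A :=
  hA.spectral_theorem.symm

lemma matFun_exp (f : ℝ → ℂ) :
    matFun hA (fun E => Complex.exp (f E)) = NormedSpace.exp (matFun hA f) := by
  have hinv : (hA.eigenvectorUnitary : Mat N)⁻¹ = star (hA.eigenvectorUnitary : Mat N) :=
    Matrix.inv_eq_right_inv (Unitary.mul_star_self_of_mem hA.eigenvectorUnitary.2)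
  have hunit : IsUnit (hA.eigenvectorUnitary : Mat N) :=
    (Unitary.toUnits hA.eigenvectorUnitary).isUnit
  rw [matFun, matFun, ← hinv, Matrix.exp_conj _ _ hunit, Matrix.exp_diagonal]
  congr 3
  ext α
  rw [Pi.coe_exp, Complex.exp_eq_exp_ℂ]

lemma exp_smul_eq_matFun (c : ℂ) :
    NormedSpace.exp (c • A) = matFun hA (fun E => Complex.exp (c * E)) := by
  rw [matFun_exp, matFun_const_mul, matFun_id]

lemma inEigenbases_matFun_sub_apply (f : ℝ → ℂ) (i j : Fin N) :
    inEigenbases hA hA' (matFun hA' f - matFun hA f) i j =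
      (f (hA'.eigenvalues i) - f (hA.eigenvalues j)) * inEigenbases hA hA' 1 i j := by
  rw [map_sub, ← mul_one (matFun hA' f), ← one_mul (matFun hA f), inEigenbases_mul hA hA' hA',
    inEigenbases_mul hA hA hA', inEigenbases_matFun, inEigenbases_matFun, Matrix.sub_apply,
    Matrix.diagonal_mul, Matrix.mul_diagonal]
  ring

lemma inEigenbases_sub_apply (i j : Fin N) : inEigenbases hA hA' (A' - A) i j =
    ((hA'.eigenvalues i : ℂ) - hA.eigenvalues j) * inEigenbases hA hA' 1 i j := by
  simpa only [matFun_id] using inEigenbases_matFun_sub_apply hA hA' (fun E => (E : ℂ)) i j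

lemma norm_inEigenbases_sub_apply (i j : Fin N) : ‖inEigenbases hA hA' (A' - A) i j‖ =
    dist (hA'.eigenvalues i) (hA.eigenvalues j) * ‖inEigenbases hA hA' 1 i j‖ := by
  rw [inEigenbases_sub_apply, norm_mul, ← Complex.ofReal_sub, Complex.norm_real, dist_eq_norm]

/-- The first variation of `f(A)` in the direction `B`, given by the Daletskii–Krein formula: in
an eigenbasis of `A` the entries of `B` are multiplied by the divided differences of `f`. -/
noncomputable def firstVariation (f : ℝ → ℂ) (B : Mat N) : Mat N :=
  (inEigenbases hA hA).symm (Matrix.of fun k j =>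
    dslope f (hA.eigenvalues j) (hA.eigenvalues k) * inEigenbases hA hA B k j)

lemma inEigenbases_firstVariation_apply (f : ℝ → ℂ) (B : Mat N) (k j : Fin N) :
    inEigenbases hA hA (firstVariation hA f B) k j =
      dslope f (hA.eigenvalues j) (hA.eigenvalues k) * inEigenbases hA hA B k j := by
  rw [firstVariation, LinearEquiv.apply_symm_apply, Matrix.of_apply]

lemma inEigenbases_matFun_sub_firstVariation_apply (f : ℝ → ℂ) (i j : Fin N) :
    inEigenbases hA hA' (matFun hA' f - matFun hA f - firstVariation hA f (A' - A)) i j =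
      ∑ k, (dslope f (hA.eigenvalues j) (hA'.eigenvalues i) -
        dslope f (hA.eigenvalues j) (hA.eigenvalues k)) *
        (inEigenbases hA hA' 1 i k * inEigenbases hA hA (A' - A) k j) := by
  have hdiff : inEigenbases hA hA' (matFun hA' f - matFun hA f) i j =
      dslope f (hA.eigenvalues j) (hA'.eigenvalues i) * inEigenbases hA hA' (A' - A) i j := by
    rw [inEigenbases_matFun_sub_apply, inEigenbases_sub_apply, ← sub_smul_dslope,
      Complex.real_smul]
    push_cast
    ring
  have hmul := inEigenbases_mul hA hA hA' 1
  simp only [one_mul] at hmul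
  rw [map_sub, Matrix.sub_apply, hdiff, hmul (A' - A), hmul (firstVariation hA f _),
    Matrix.mul_apply, Matrix.mul_apply, Finset.mul_sum, ← Finset.sum_sub_distrib]
  refine Finset.sum_congr rfl fun k _ => ?_
  rw [inEigenbases_firstVariation_apply]
  ring

section Norm

open scoped Matrix.Norms.Frobenius

variable {f f' : ℝ → ℂ} {K : ℝ≥0}

lemma norm_inEigenbases (B : Mat N) : ‖inEigenbases hA hA' B‖ = ‖B‖ :=
  (frobenius_norm_mul_unitary hA.eigenvectorUnitary.2 _).trans
    (frobenius_norm_unitary_mul (Unitary.star_mem hA'.eigenvectorUnitary.2) B)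

lemma norm_matFun_sub_le (hf : LipschitzWith K f) :
    ‖matFun hA' f - matFun hA f‖ ≤ K * ‖A' - A‖ := by
  rw [← norm_inEigenbases hA hA', ← norm_inEigenbases hA hA' (A' - A), ← NNReal.norm_eq K,
    ← norm_smul]
  refine frobenius_norm_mono fun i j => ?_
  rw [Matrix.smul_apply, norm_smul, NNReal.norm_eq, norm_inEigenbases_sub_apply,
    inEigenbases_matFun_sub_apply, norm_mul, ← mul_assoc,
    ← dist_eq_norm]
  gcongr
  exact hf.dist_le_mul _ _

lemma norm_matFun_sub_firstVariation_le (hf : ∀ x, HasDerivAt f (f' x) x)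
    (hf' : LipschitzWith K f') :
    ‖matFun hA' f - matFun hA f - firstVariation hA f (A' - A)‖ ≤ K * ‖A' - A‖ ^ 2 := by
  set X := inEigenbases hA hA' (A' - A)
  set Z := inEigenbases hA hA (A' - A)
  have hentry : ∀ i j, ‖inEigenbases hA hA'
      (matFun hA' f - matFun hA f - firstVariation hA f (A' - A)) i j‖ ≤
        ‖((K : ℝ) • (X.map norm * Z.map norm)) i j‖ := fun i j => by
    rw [inEigenbases_matFun_sub_firstVariation_apply, Matrix.smul_apply, Matrix.mul_apply,
      smul_eq_mul, Finset.mul_sum]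
    refine (norm_sum_le_of_le _ fun k _ => ?_).trans (Real.le_norm_self _)
    rw [norm_mul, norm_mul, Matrix.map_apply, Matrix.map_apply, norm_inEigenbases_sub_apply,
      ← dist_eq_norm, ← mul_assoc, ← mul_assoc, ← mul_assoc]
    gcongr
    exact (lipschitzWith_dslope hf hf' _).dist_le_mul _ _
  calc ‖matFun hA' f - matFun hA f - firstVariation hA f (A' - A)‖
      ≤ ‖(K : ℝ) • (X.map norm * Z.map norm)‖ := by
        rw [← norm_inEigenbases hA hA']
        exact frobenius_norm_mono hentry
    _ ≤ K * (‖X.map norm‖ * ‖Z.map norm‖) := by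
        rw [norm_smul, NNReal.norm_eq]
        gcongr
        exact Matrix.frobenius_norm_mul _ _
    _ = K * ‖A' - A‖ ^ 2 := by
        rw [Matrix.frobenius_norm_map_eq _ _ norm_norm, Matrix.frobenius_norm_map_eq _ _ norm_norm,
          norm_inEigenbases, norm_inEigenbases, sq]

end Norm

end HermitianCalculus

section OrderedDifference

variable {N : ℕ} {F : ℂ → ℂ}

lemma eigenvalues_mem_eigenvalueSet {A : Mat N} (hA : A.IsHermitian) (i : Fin N) :
    hA.eigenvalues i ∈ eigenvalueSet hA :=
  Finset.mem_image_of_mem _ (Finset.mem_univ i)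

lemma sum_smul_specProj {A : Mat N} (hA : A.IsHermitian) :
    ∑ a ∈ eigenvalueSet hA, (a : ℂ) • specProj hA a = A := by
  refine Eq.trans ?_ (matFun_id hA)
  apply (inEigenbases hA hA).injective
  ext i j
  simp only [map_sum, map_smul, specProj, inEigenbases_matFun, Matrix.sum_apply,
    Matrix.smul_apply, Matrix.diagonal_apply, smul_eq_mul]
  split_ifs
  · simp [eigenvalues_mem_eigenvalueSet]
  · simp

lemma inEigenbases_specProj_mul_mul_specProj_apply {A : Mat N} (hA : A.IsHermitian) (B : Mat N)
    (a b : ℝ) (k j : Fin N) :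
    inEigenbases hA hA (specProj hA b * B * specProj hA a) k j =
      (if hA.eigenvalues k = b then 1 else 0) * inEigenbases hA hA B k j *
        (if hA.eigenvalues j = a then 1 else 0) := by
  rw [inEigenbases_mul hA hA hA, inEigenbases_mul hA hA hA, specProj, specProj,
    inEigenbases_matFun, inEigenbases_matFun, Matrix.mul_diagonal, Matrix.diagonal_mul]

lemma inEigenbases_orderedDiff_apply {H₀ H₂ : Mat N} (h₀ : H₀.IsHermitian) (h₂ : H₂.IsHermitian)
    (F : ℂ → ℂ) (k j : Fin N) :
    inEigenbases h₀ h₀ (orderedDiff h₀ h₂ F) k j =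
      diffDeriv F (-I * h₀.eigenvalues j) (-I * h₀.eigenvalues k) *
        inEigenbases h₀ h₀ H₂ k j := by
  have hH₂ : inEigenbases h₀ h₀ H₂ k j =
      ∑ a ∈ eigenvalueSet h₂, (a : ℂ) * inEigenbases h₀ h₀ (specProj h₂ a) k j := by
    nth_rw 1 [← sum_smul_specProj h₂]
    simp only [map_sum, map_smul, Matrix.sum_apply, Matrix.smul_apply, smul_eq_mul]
  simp only [orderedDiff, feynman213, hH₂, Finset.mul_sum, map_sum, map_smul, Matrix.sum_apply,
    Matrix.smul_apply, inEigenbases_specProj_mul_mul_specProj_apply, smul_eq_mul]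
  refine Finset.sum_congr rfl fun a _ => ?_
  rw [Finset.sum_eq_single_of_mem _ (eigenvalues_mem_eigenvalueSet h₀ j) fun b _ hb => by
    simp [hb.symm],
    Finset.sum_eq_single_of_mem _ (eigenvalues_mem_eigenvalueSet h₀ k) fun b _ hb => by
    simp [hb.symm], if_pos rfl, if_pos rfl]
  ring

lemma neg_I_mul_mem_closedHalfPlane (E : ℝ) : -I * E ∈ closedHalfPlane := by
  simp [mem_closedHalfPlane]

lemma isometry_neg_I_mul : Isometry fun E : ℝ => -I * E :=
  Isometry.of_dist_eq fun x y => by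
    rw [dist_eq_norm, ← mul_sub, norm_mul, norm_neg, Complex.norm_I, one_mul, ← Complex.ofReal_sub,
      Complex.norm_real, dist_eq_norm]

lemma hasDerivAt_comp_neg_I_mul (hF : DifferentiableOn ℂ F closedHalfPlane) (E : ℝ) :
    HasDerivAt (fun E : ℝ => F (-I * E)) (-I * hpDeriv F (-I * E)) E := by
  have hline : HasDerivAt (fun E : ℝ => -I * (E : ℂ)) (-I) E := by
    simpa using (Complex.ofRealCLM.hasDerivAt (x := E)).const_mul (-I)
  rw [← hasDerivWithinAt_univ]
  exact (hF _ (neg_I_mul_mem_closedHalfPlane E)).hasDerivWithinAt.scomp E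
    hline.hasDerivWithinAt fun E _ => neg_I_mul_mem_closedHalfPlane E

lemma dslope_comp_neg_I_mul (hF : DifferentiableOn ℂ F closedHalfPlane) (x y : ℝ) :
    dslope (fun E : ℝ => F (-I * E)) x y =
      -I * diffDeriv F (-I * x) (-I * y) := by
  rcases eq_or_ne y x with rfl | h
  · rw [dslope_same, (hasDerivAt_comp_neg_I_mul hF y).deriv, diffDeriv, if_pos rfl]
  · have hne : (y : ℂ) - x ≠ 0 := sub_ne_zero.2 (by exact_mod_cast h)
    have hsub : -I * (x : ℂ) - -I * y = I * (y - x) := by ring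
    rw [dslope_of_ne _ h, slope_def_module, diffDeriv,
      if_neg fun hxy => h (isometry_neg_I_mul.injective hxy).symm, Complex.real_smul, hsub]
    have := Complex.I_ne_zero
    push_cast
    field_simp
    ring

lemma firstVariation_smul_eq_orderedDiff (hF : DifferentiableOn ℂ F closedHalfPlane)
    {H₀ H₂ : Mat N} (h₀ : H₀.IsHermitian) (h₂ : H₂.IsHermitian) (c : ℂ) :
    firstVariation h₀ (fun E : ℝ => F (-I * E)) (c • H₂) =
      -(c • (I • orderedDiff h₀ h₂ F)) := by
  rw [← neg_smul]
  apply (inEigenbases h₀ h₀).injective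
  ext k j
  simp only [inEigenbases_firstVariation_apply, map_smul, Matrix.smul_apply, smul_eq_mul,
    inEigenbases_orderedDiff_apply, dslope_comp_neg_I_mul hF]
  ring

end OrderedDifference

section Propagator

variable {N : ℕ}

lemma linearMap_apply_eq_sum (φ : Mat N →ₗ[ℂ] ℂ) (B : Mat N) :
    φ B = ∑ i, ∑ j, B i j * φ (Matrix.single i j 1) := by
  simp_rw [← smul_eq_mul, ← map_smul, Matrix.smul_single, smul_eq_mul, mul_one, ← map_sum,
    ← Matrix.matrix_eq_sum_single]

lemma intervalIntegral_linearMap_apply (φ : Mat N →ₗ[ℂ] ℂ) {Φ : ℝ → Mat N} {a b : ℝ}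
    (hΦ : ∀ i j, IntervalIntegrable (fun s => Φ s i j) volume a b) :
    ∫ s in a..b, φ (Φ s) = ∑ i, ∑ j, (∫ s in a..b, Φ s i j) * φ (Matrix.single i j 1) := by
  simp_rw [linearMap_apply_eq_sum φ (Φ _)]
  have hrow : ∀ i, IntervalIntegrable (fun s => ∑ j, Φ s i j * φ (Matrix.single i j 1)) volume
      a b := fun i => by
    simpa only [Finset.sum_fn] using IntervalIntegrable.sum Finset.univ
      fun j _ => (hΦ i j).mul_const (φ (Matrix.single i j 1))
  rw [intervalIntegral.integral_finsetSum fun i _ => hrow i]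
  refine Finset.sum_congr rfl fun i _ => ?_
  rw [intervalIntegral.integral_finsetSum fun j _ => (hΦ i j).mul_const _]
  simp only [intervalIntegral.integral_mul_const]

variable {K : ℝ → ℂ} {H : Mat N} {V : ℝ → Mat N}

open scoped Matrix.Norms.L2Operator in
lemma continuous_exp_smul (H : Mat N) {c : ℝ → ℂ} (hc : Continuous c) :
    Continuous fun s => NormedSpace.exp (c s • H) :=
  continuous_iff_continuousAt.2 fun _ => (NormedSpace.exp_analytic (𝕂 := ℂ) _).continuousAt.comp
    (hc.smul continuous_const).continuousAt

lemma IsPropagator.continuousOn (hV : IsPropagator K H V) : ContinuousOn V (Ici 0) :=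
  continuousOn_pi.2 fun i => continuousOn_pi.2 fun j t ht => (hV.2 t ht i j).continuousWithinAt

lemma IsPropagator.hasDerivWithinAt_linearMap (hV : IsPropagator K H V) (hK : Continuous K)
    (φ : Mat N →ₗ[ℂ] ℂ) {t : ℝ} (ht : 0 ≤ t) :
    HasDerivWithinAt (fun u => φ (V u))
      (-∫ s in (0 : ℝ)..t,
        φ (K (t - s) • (NormedSpace.exp ((I * ((t - s : ℝ) : ℂ)) • H) * V s)))
      (Ici 0) t := by
  have hcont : ContinuousOn (fun s =>
      K (t - s) • (NormedSpace.exp ((I * ((t - s : ℝ) : ℂ)) • H) * V s)) (uIcc 0 t) := by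
    rw [uIcc_of_le ht]
    exact (by fun_prop : Continuous fun s => K (t - s)).continuousOn.smul
      ((continuous_exp_smul H (by fun_prop)).continuousOn.mul
        (hV.continuousOn.mono Icc_subset_Ici_self))
  rw [intervalIntegral_linearMap_apply φ fun i j => ContinuousOn.intervalIntegrable
    (continuousOn_pi.1 (continuousOn_pi.1 hcont i) j)]
  simp_rw [linearMap_apply_eq_sum φ (V _), ← Finset.sum_neg_distrib, ← neg_mul]
  exact HasDerivWithinAt.fun_sum fun i _ => HasDerivWithinAt.fun_sum fun j _ =>
    (hV.2 t ht i j).mul_const _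

lemma IsPropagator.hasDerivWithinAt_inEigenbases (hV : IsPropagator K H V) (hK : Continuous K)
    (hH : H.IsHermitian) (α β : Fin N) {t : ℝ} (ht : 0 ≤ t) :
    HasDerivWithinAt (fun u => inEigenbases hH hH (V u) α β)
      (-∫ s in (0 : ℝ)..t, K (t - s) * (Complex.exp (I * hH.eigenvalues α * (t - s : ℝ)) *
        inEigenbases hH hH (V s) α β)) (Ici 0) t := by
  refine (hV.hasDerivWithinAt_linearMap hK
    (Matrix.entryLinearMap ℂ ℂ α β ∘ₗ (inEigenbases hH hH).toLinearMap) ht).congr_deriv ?_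
  congr 2 with s
  simp only [LinearMap.comp_apply, LinearEquiv.coe_coe, Matrix.entryLinearMap_apply, map_smul,
    smul_eq_mul]
  rw [exp_smul_eq_matFun hH, inEigenbases_mul hH hH hH, inEigenbases_matFun, Matrix.diagonal_mul,
    mul_right_comm I]

lemma IsPropagator.continuous_inEigenbases (hV : IsPropagator K H V) (hH : H.IsHermitian)
    (α β : Fin N) : Continuous fun t => inEigenbases hH hH (V (max t 0)) α β := by
  have hVmax : Continuous fun t => V (max t 0) :=
    hV.continuousOn.comp_continuous (by fun_prop) fun t => le_max_right t 0
  exact ((continuous_const.matrix_mul hVmax).matrix_mul continuous_const).matrix_elem α β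

lemma IsPropagator.hasDerivAt_volterra {ν : Measure ℝ} [IsFiniteMeasure ν] {ε : ℝ}
    (hV : IsPropagator (fun t => (ε : ℂ) * charFun ν t) H V) (hH : H.IsHermitian) (α β : Fin N)
    {t : ℝ} (ht : 0 < t) :
    HasDerivAt (fun t => inEigenbases hH hH (V (max t 0)) α β)
      (-(ε * ∫ u in (0 : ℝ)..t, charFun (ν.map (· + hH.eigenvalues α)) (t - u) *
          inEigenbases hH hH (V (max u 0)) α β)) t := by
  refine (((hV.hasDerivWithinAt_inEigenbases (continuous_const.mul continuous_charFun) hH α β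
    ht.le).hasDerivAt (Ici_mem_nhds ht)).congr_of_eventuallyEq ?_).congr_deriv ?_
  · filter_upwards [Ioi_mem_nhds ht] with s hs
    rw [max_eq_left (le_of_lt hs)]
  · rw [← intervalIntegral.integral_const_mul]
    congr 1
    refine intervalIntegral.integral_congr fun s hs => ?_
    rw [uIcc_of_le ht.le] at hs
    simp only [charFun_map_add_const_real, max_eq_left hs.1]
    ring

end Propagator

section Asymptotics

variable {ι 𝔸 : Type*} [NormedRing 𝔸] {l : Filter ι}

lemma isBigO_mul_sub_mul {f f' g g' : ι → 𝔸} {s : ι → ℂ}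
    (hf : (fun x => f x - f' x) =O[l] s) (hg : (fun x => g x - g' x) =O[l] s)
    (hf' : f' =O[l] fun _ => (1 : ℂ)) (hg' : g =O[l] fun _ => (1 : ℂ)) :
    (fun x => f x * g x - f' x * g' x) =O[l] s := by
  have hleft : (fun x => (f x - f' x) * g x) =O[l] s := by simpa using hf.mul hg'
  have hright : (fun x => f' x * (g x - g' x)) =O[l] s := by simpa using hf'.mul hg
  exact (hleft.add hright).congr_left fun x => by noncomm_ring

variable [NormedAlgebra ℂ 𝔸]

lemma smul_sub_smul_isBigO {s : ι → ℂ} {f : ι → 𝔸} {a : 𝔸}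
    (hf : (fun x => f x - a) =O[l] s) :
    (fun x => s x • f x - s x • a) =O[l] fun x => s x ^ 2 := by
  simpa only [smul_sub, smul_eq_mul, ← sq] using (isBigO_refl s l).smul hf

variable [CompleteSpace 𝔸]

lemma exp_sub_exp_isBigO {f g : ι → 𝔸} {a : 𝔸} (hf : Tendsto f l (𝓝 a))
    (hg : Tendsto g l (𝓝 a)) :
    (fun x => NormedSpace.exp (f x) - NormedSpace.exp (g x)) =O[l] fun x => f x - g x :=
  (NormedSpace.exp_analytic (𝕂 := ℂ) a).hasStrictFDerivAt.isBigO_sub.comp_tendsto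
    (hf.prodMk_nhds hg)

lemma exp_mul_sub_exp_mul_isBigO {s : ι → ℂ} (hs : Tendsto s l (𝓝 0)) {Q₀ Q₁ : ι → 𝔸}
    {P₀ P₁ D : 𝔸} (t : ℂ)
    (hQ₀ : (fun x => Q₀ x - (P₀ - s x • D)) =O[l] fun x => s x ^ 2)
    (hQ₁ : (fun x => Q₁ x - P₁) =O[l] s) :
    (fun x => NormedSpace.exp (t • (-Q₀ x + s x • (Q₁ x * Q₀ x))) * (1 - s x • Q₁ x) -
      NormedSpace.exp (t • (-P₀ + s x • (P₁ * P₀ + D))) * (1 - s x • P₁)) =O[l]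
      fun x => s x ^ 2 := by
  have hs_sq : (fun x => s x ^ 2) =O[l] s := by
    simpa [sq] using (hs.isBigO_one ℂ).mul (isBigO_refl s l)
  have hQ₀_zero : (fun x => Q₀ x - P₀) =O[l] s := by
    have hsD : (fun x => s x • D) =O[l] s := by
      simpa using (isBigO_refl s l).smul (isBigO_const_const D (one_ne_zero (α := ℂ)) l)
    exact ((hQ₀.trans hs_sq).sub hsD).congr_left fun x => by abel
  have hQ₀_tendsto : Tendsto Q₀ l (𝓝 P₀) :=
    tendsto_sub_nhds_zero_iff.1 (hQ₀_zero.trans_tendsto hs)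
  have hQ₁_tendsto : Tendsto Q₁ l (𝓝 P₁) :=
    tendsto_sub_nhds_zero_iff.1 (hQ₁.trans_tendsto hs)
  have hprod : (fun x => Q₁ x * Q₀ x - P₁ * P₀) =O[l] s :=
    isBigO_mul_sub_mul hQ₁ hQ₀_zero (isBigO_const_const P₁ one_ne_zero l)
      (hQ₀_tendsto.isBigO_one ℂ)
  have hgen : (fun x => t • (-Q₀ x + s x • (Q₁ x * Q₀ x)) -
      t • (-P₀ + s x • (P₁ * P₀ + D))) =O[l] fun x => s x ^ 2 := by
    refine (((smul_sub_smul_isBigO hprod).sub hQ₀).const_smul_left t).congr_left fun x => ?_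
    simp only [Pi.smul_apply]
    module
  have hgen_tendsto : Tendsto (fun x => t • (-P₀ + s x • (P₁ * P₀ + D))) l (𝓝 (t • -P₀)) := by
    simpa using ((tendsto_const_nhds (x := -P₀)).add (hs.smul_const (P₁ * P₀ + D))).const_smul t
  have hgen_tendsto' : Tendsto (fun x => t • (-Q₀ x + s x • (Q₁ x * Q₀ x))) l (𝓝 (t • -P₀)) := by
    simpa using (hQ₀_tendsto.neg.add (hs.smul (hQ₁_tendsto.mul hQ₀_tendsto))).const_smul t
  have hres : (fun x => (1 - s x • Q₁ x) - (1 - s x • P₁)) =O[l] fun x => s x ^ 2 := by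
    simpa only [sub_sub_sub_cancel_left] using (smul_sub_smul_isBigO hQ₁).symm
  exact isBigO_mul_sub_mul ((exp_sub_exp_isBigO hgen_tendsto' hgen_tendsto).trans hgen) hres
    (((NormedSpace.exp_analytic (𝕂 := ℂ) _).continuousAt.tendsto.comp hgen_tendsto).isBigO_one ℂ)
    ((tendsto_const_nhds.sub (hs.smul hQ₁_tendsto)).isBigO_one ℂ)

end Asymptotics

section WeakCoupling

variable {N : ℕ} {F : ℂ → ℂ} {K B : ℝ≥0} {H₀ H₂ : Mat N}

lemma matFun_residue_mul_exp {A : Mat N} (hA : A.IsHermitian) (F : ℂ → ℂ) (ε t : ℝ) :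
    matFun hA (fun E => residue F (-I * E) ε *
      Complex.exp (-F (-I * E) * residue F (-I * E) ε * t)) =
    NormedSpace.exp ((t : ℂ) •
        (-funNegI hA F + (ε : ℂ) • (funNegI hA (hpDeriv F) * funNegI hA F))) *
      (1 - (ε : ℂ) • funNegI hA (hpDeriv F)) := by
  have hfun : (fun E : ℝ => residue F (-I * E) ε *
      Complex.exp (-F (-I * E) * residue F (-I * E) ε * t)) =
      fun E : ℝ => Complex.exp (t * (ε * (hpDeriv F (-I * E) * F (-I * E)) -
        F (-I * E))) * (1 - ε * hpDeriv F (-I * E)) := by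
    ext E
    rw [mul_comm, residue]
    congr 2
    ring
  simp only [funNegI]
  rw [hfun, matFun_mul, matFun_exp, matFun_const_mul, matFun_sub, matFun_const_mul, matFun_mul,
    matFun_sub, matFun_const_mul, matFun_one, neg_add_eq_sub]

lemma isHermitian_add_ofReal_smul (h₀ : H₀.IsHermitian) (h₂ : H₂.IsHermitian) (c : ℝ) :
    (H₀ + (c : ℂ) • H₂).IsHermitian :=
  h₀.add (h₂.smul (Complex.conj_ofReal c))

lemma lipschitzWith_hpDeriv_neg_I_mul (hF' : LipschitzOnWith K (hpDeriv F) closedHalfPlane) :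
    LipschitzWith K fun E : ℝ => hpDeriv F (-I * E) := by
  have hline := hF'.comp isometry_neg_I_mul.lipschitz.lipschitzOnWith
    fun E (_ : E ∈ univ) => neg_I_mul_mem_closedHalfPlane E
  rwa [mul_one, lipschitzOnWith_univ] at hline

open scoped Matrix.Norms.Frobenius

lemma norm_funNegI_hpDeriv_sub_le (hF' : LipschitzOnWith K (hpDeriv F) closedHalfPlane)
    (h₀ : H₀.IsHermitian) {c : ℂ} (h : (H₀ + c • H₂).IsHermitian) :
    ‖funNegI h (hpDeriv F) - funNegI h₀ (hpDeriv F)‖ ≤ K * ‖c • H₂‖ := by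
  have hbound := norm_matFun_sub_le h₀ h (lipschitzWith_hpDeriv_neg_I_mul hF')
  rwa [add_sub_cancel_left] at hbound

lemma norm_funNegI_sub_orderedDiff_le (hF : DifferentiableOn ℂ F closedHalfPlane)
    (hF' : LipschitzOnWith K (hpDeriv F) closedHalfPlane) (h₀ : H₀.IsHermitian)
    (h₂ : H₂.IsHermitian) {c : ℂ} (h : (H₀ + c • H₂).IsHermitian) :
    ‖funNegI h F - (funNegI h₀ F - c • (I • orderedDiff h₀ h₂ F))‖ ≤
      K * ‖c • H₂‖ ^ 2 := by
  have hlip : LipschitzWith K fun E : ℝ => -I * hpDeriv F (-I * E) := by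
    simpa [Function.comp_def] using
      (lipschitzWith_smul (-I)).comp (lipschitzWith_hpDeriv_neg_I_mul hF')
  have hbound := norm_matFun_sub_firstVariation_le h₀ h (hasDerivAt_comp_neg_I_mul hF) hlip
  rwa [add_sub_cancel_left, firstVariation_smul_eq_orderedDiff hF h₀ h₂, sub_neg_eq_add,
    ← funNegI, ← funNegI, sub_add] at hbound

lemma IsPropagator.sq_mul_norm_sub_matFun_le {ν : Measure ℝ} [IsFiniteMeasure ν]
    (hF : IsBoundedC11 F B) (hν : IsLaplaceTransform (charFun ν) F) {ε : ℝ} (hε : 0 < ε)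
    (hεB : ε * B ≤ 1 / 2) {H : Mat N} {V : ℝ → Mat N}
    (hV : IsPropagator (fun t => (ε : ℂ) * charFun ν t) H V) (hH : H.IsHermitian) {t : ℝ}
    (ht : 0 < t) :
    t ^ 2 * ‖V (ε⁻¹ * t) - matFun hH (fun E => residue F (-I * E) ε *
        Complex.exp (-F (-I * E) * residue F (-I * E) ε * t))‖ ≤
      500 * ((2 * B ^ 2 + B) * ε ^ 2) * Real.exp ((6 * B + 2) * t) / (2 * (6 * B + 2)) *
        ‖(1 : Mat N)‖ := by
  set M := 500 * ((2 * B ^ 2 + B) * ε ^ 2) * Real.exp ((6 * B + 2) * t) / (2 * (6 * B + 2))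
  have hM : 0 ≤ M := by positivity
  set f : ℝ → ℂ := fun E => residue F (-I * E) ε *
    Complex.exp (-F (-I * E) * residue F (-I * E) ε * t)
  have hentry : ∀ α β, ‖(t ^ 2 • inEigenbases hH hH (V (ε⁻¹ * t) - matFun hH f)) α β‖ ≤
      ‖(M • (1 : Mat N)) α β‖ := fun α β => by
    have hscalar := hF.sq_mul_norm_volterra_sub_exp_le hν hε hεB rfl
      (hV.continuous_inEigenbases hH α β) (fun s hs => hV.hasDerivAt_volterra hH α β hs) ht
    have hmodel : inEigenbases hH hH (matFun hH f) α β =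
        (1 : Mat N) α β * f (hH.eigenvalues α) := by
      rw [inEigenbases_matFun, Matrix.diagonal_apply, Matrix.one_apply]
      split_ifs <;> simp
    rw [max_self, hV.1, inEigenbases_self_one, max_eq_left (by positivity)] at hscalar
    rw [map_sub, Matrix.smul_apply, Matrix.sub_apply, hmodel, Matrix.smul_apply, norm_smul,
      norm_smul, Real.norm_of_nonneg (sq_nonneg t), Real.norm_of_nonneg hM]
    refine hscalar.trans_eq ?_
    ring
  have hnorm := frobenius_norm_mono hentry
  rwa [norm_smul, norm_smul, norm_inEigenbases, Real.norm_of_nonneg (sq_nonneg t),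
    Real.norm_of_nonneg hM] at hnorm

lemma apply_isBigO {ι : Type*} (f : ι → Mat N) (l : Filter ι) (i j : Fin N) :
    (fun x => f x i j) =O[l] f :=
  (LinearMap.toContinuousLinearMap (Matrix.entryLinearMap ℂ ℂ i j)).isBigO_comp f l

lemma propagator_sub_matFun_isBigO {ν : Measure ℝ} [IsFiniteMeasure ν]
    (hF : IsBoundedC11 F B) (hν : IsLaplaceTransform (charFun ν) F)
    (hH : ∀ lam : ℝ, (H₀ + ((lam ^ 2 : ℝ) : ℂ) • H₂).IsHermitian) {V : ℝ → ℝ → Mat N}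
    (hV : ∀ lam : ℝ, lam ≠ 0 → IsPropagator (fun t => ((lam ^ 2 : ℝ) : ℂ) * charFun ν t)
      (H₀ + ((lam ^ 2 : ℝ) : ℂ) • H₂) (V lam)) {t : ℝ} (ht : 0 < t) :
    (fun lam : ℝ => V lam ((lam ^ 2)⁻¹ * t) - matFun (hH lam) (fun E =>
      residue F (-I * E) (lam ^ 2) * Complex.exp
        (-F (-I * E) * residue F (-I * E) (lam ^ 2) * t)))
      =O[𝓝[≠] 0] fun lam : ℝ => ((lam ^ 2 : ℝ) : ℂ) ^ 2 := by
  have hsmall : ∀ᶠ lam : ℝ in 𝓝[≠] 0, lam ^ 2 * B < 1 / 2 :=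
    nhdsWithin_le_nhds <| (by fun_prop : Continuous fun lam : ℝ => lam ^ 2 * B).tendsto 0
      |>.eventually_lt_const (by norm_num)
  refine IsBigO.of_bound (500 * (2 * B ^ 2 + B) * Real.exp ((6 * B + 2) * t) / (2 * (6 * B + 2)) *
    ‖(1 : Mat N)‖ / t ^ 2) ?_
  filter_upwards [hsmall, self_mem_nhdsWithin] with lam hlam hlam₀
  have hbound := (hV lam hlam₀).sq_mul_norm_sub_matFun_le hF hν (sq_pos_of_ne_zero hlam₀) hlam.le
    (hH lam) ht
  rw [norm_pow, Complex.norm_real, Real.norm_of_nonneg (sq_nonneg lam), div_mul_eq_mul_div,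
    le_div_iff₀' (pow_pos ht 2)]
  refine hbound.trans_eq ?_
  ring

lemma propagator_sub_exp_mul_isBigO {ν : Measure ℝ} [IsFiniteMeasure ν]
    (hF : IsBoundedC11 F B) (hν : IsLaplaceTransform (charFun ν) F) (h₀ : H₀.IsHermitian)
    (h₂ : H₂.IsHermitian) {V : ℝ → ℝ → Mat N}
    (hV : ∀ lam : ℝ, lam ≠ 0 → IsPropagator (fun t => ((lam ^ 2 : ℝ) : ℂ) * charFun ν t)
      (H₀ + ((lam ^ 2 : ℝ) : ℂ) • H₂) (V lam)) {t : ℝ} (ht : 0 < t) :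
    (fun lam : ℝ => V lam ((lam ^ 2)⁻¹ * t) -
      NormedSpace.exp ((t : ℂ) • LMat h₀ h₂ F lam) * rMat h₀ F lam)
      =O[𝓝[≠] 0] fun lam : ℝ => ((lam ^ 2 : ℝ) : ℂ) ^ 2 := by
  have hH : ∀ lam : ℝ, (H₀ + ((lam ^ 2 : ℝ) : ℂ) • H₂).IsHermitian :=
    fun lam => isHermitian_add_ofReal_smul h₀ h₂ (lam ^ 2)
  have hs : Tendsto (fun lam : ℝ => ((lam ^ 2 : ℝ) : ℂ)) (𝓝[≠] 0) (𝓝 0) :=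
    Tendsto.mono_left (Continuous.tendsto' (by fun_prop) 0 0 (by simp)) nhdsWithin_le_nhds
  have hQ₀ : (fun lam => funNegI (hH lam) F - (funNegI h₀ F -
      ((lam ^ 2 : ℝ) : ℂ) • (I • orderedDiff h₀ h₂ F))) =O[𝓝[≠] 0]
      fun lam : ℝ => ((lam ^ 2 : ℝ) : ℂ) ^ 2 :=
    IsBigO.of_bound (B * ‖H₂‖ ^ 2) <| .of_forall fun lam =>
      (norm_funNegI_sub_orderedDiff_le hF.differentiableOn hF.lipschitzOnWith h₀ h₂
        (hH lam)).trans_eq <| by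
        rw [norm_smul, norm_pow]
        ring
  have hQ₁ : (fun lam => funNegI (hH lam) (hpDeriv F) - funNegI h₀ (hpDeriv F)) =O[𝓝[≠] 0]
      fun lam : ℝ => ((lam ^ 2 : ℝ) : ℂ) :=
    IsBigO.of_bound (B * ‖H₂‖) <| .of_forall fun lam =>
      (norm_funNegI_hpDeriv_sub_le hF.lipschitzOnWith h₀ (hH lam)).trans_eq <| by
        rw [norm_smul]
        ring
  have hmodel := propagator_sub_matFun_isBigO hF hν hH hV ht
  simp only [matFun_residue_mul_exp] at hmodel
  exact (hmodel.add (exp_mul_sub_exp_mul_isBigO hs (t : ℂ) hQ₀ hQ₁)).congr_left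
    fun lam => sub_add_sub_cancel _ _ _

end WeakCoupling

end RWAModel

theorem theorem2_general {N : ℕ} (ν : Measure ℝ) [IsFiniteMeasure ν] (Gt : ℂ → ℂ)
    (hGt : RWAModel.IsLaplaceTransform (charFun ν) Gt)
    (hd : DifferentiableOn ℂ Gt RWAModel.closedHalfPlane) {K : NNReal}
    (hlip : LipschitzOnWith K (RWAModel.hpDeriv Gt) RWAModel.closedHalfPlane)
    (H₀ H₂ : Matrix (Fin N) (Fin N) ℂ) (h₀ : H₀.IsHermitian) (h₂ : H₂.IsHermitian)
    (V W : ℝ → ℝ → Matrix (Fin N) (Fin N) ℂ)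
    (hV : ∀ lam : ℝ, lam ≠ 0 →
      RWAModel.IsPropagator (fun t => ((lam ^ 2 : ℝ) : ℂ) * charFun ν t)
        (H₀ + ((lam ^ 2 : ℝ) : ℂ) • H₂) (V lam))
    (hW : ∀ lam : ℝ, lam ≠ 0 → ∀ t : ℝ, W lam t = V lam ((lam ^ 2)⁻¹ * t))
    (t : ℝ) (ht : 0 < t) (i j : Fin N) :
    (fun lam : ℝ =>
      (W lam t - NormedSpace.exp ((t : ℂ) • RWAModel.LMat h₀ h₂ Gt lam) *
        RWAModel.rMat h₀ Gt lam) i j)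
      =O[𝓝[≠] (0 : ℝ)] (fun lam : ℝ => lam ^ 4) := by
  obtain ⟨B, hB⟩ := RWAModel.exists_isBoundedC11 hd hlip
    (C := ⟨ν.real univ, measureReal_nonneg⟩) fun p hp => hGt.norm_le_of_charFun hp
  have hpow : (fun lam : ℝ => ((lam ^ 2 : ℝ) : ℂ) ^ 2) =O[𝓝[≠] 0] fun lam : ℝ => lam ^ 4 :=
    isBigO_of_le _ fun lam => by
      rw [norm_pow, Complex.norm_real, ← norm_pow, ← pow_mul]
  open scoped Matrix.Norms.Frobenius in
  refine (((RWAModel.apply_isBigO _ _ i j).trans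
    (RWAModel.propagator_sub_exp_mul_isBigO hB hGt h₀ h₂ hV ht)).trans hpow).congr' ?_ .rfl
  filter_upwards [self_mem_nhdsWithin] with lam hlam
  rw [hW lam hlam]

theorem theorem2 {N : ℕ} (g : ℝ → ℂ) (ω : ℝ → ℝ) (hG : RWAModel.BathAdmissible g ω)
    (Gt : ℂ → ℂ) (hGt : RWAModel.IsLaplaceTransform (RWAModel.bathCorrelation g ω) Gt)
    (hC2 : RWAModel.IsBoundedC2 Gt)
    (H₀ H₂ : Matrix (Fin N) (Fin N) ℂ) (h₀ : H₀.IsHermitian) (h₂ : H₂.IsHermitian)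
    (V W : ℝ → ℝ → Matrix (Fin N) (Fin N) ℂ)
    (hV : ∀ lam : ℝ, lam ≠ 0 →
      RWAModel.IsPropagator
        (fun t => ((lam ^ 2 : ℝ) : ℂ) * RWAModel.bathCorrelation g ω t)
        (H₀ + ((lam ^ 2 : ℝ) : ℂ) • H₂) (V lam))
    (hW : ∀ lam : ℝ, lam ≠ 0 → ∀ t : ℝ, W lam t = V lam ((lam ^ 2)⁻¹ * t))
    (t : ℝ) (ht : 0 < t) (i j : Fin N) :
    (fun lam : ℝ =>
      (W lam t - NormedSpace.exp ((t : ℂ) • RWAModel.LMat h₀ h₂ Gt lam) *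
        RWAModel.rMat h₀ Gt lam) i j)
      =O[𝓝[≠] (0 : ℝ)] (fun lam : ℝ => lam ^ 4) := by
  obtain ⟨ν, _, hν⟩ := hG.exists_charFun_eq
  obtain ⟨K, hK⟩ := hC2.exists_lipschitzOnWith
  exact theorem2_general ν Gt (hν ▸ hGt) (hC2.1.differentiableOn two_ne_zero) hK H₀ H₂ h₀ h₂ V W
    (hν ▸ hV) hW t ht i j
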